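/- Let $d\ge 2$ and $M\ge 1$. For $i=1,\dots,M$ let $U_i\subset\mathbb{R}^{d-1}$ be open and let $\chi_i:U_i\to\mathbb{R}^d$ be a smooth embedding (a $C^\infty$ immersion that is a homeomorphism onto its image) such that the hypersurface $\chi_i(U_i)$ has nonvanishing Gaussian (Gauss–Kronecker) curvature at every point; let $\sigma_i$ be its surface measure. Put $S=\bigcup_i\chi_i(U_i)$, assume $S\neq\emptyset$, and define $$d\sigma_S(p)=\sum_{i=1}^M m(p)^{-1}\,d\sigma_i(p),\qquad m(p)=\#\{i: p\in\chi_i(U_i)\}.$$ A submanifold $S'$ compactly contained in $S$ is given by open sets $V_i\subset U_i$ (possibly empty) whose closures $\overline{V_i}$ are compact and contained in $U_i$, via $S'=\bigcup_i\chi_i(V_i)$. Its union of normal lines is $$\mathcal{C}_{S'}=\bigcup_i\bigcup_{x\in V_i}\big(d\chi_i(x)(\mathbb{R}^{d-1})\big)^{\perp}\subset\mathbb{R}^d,$$ the union of the one-dimensional linear subspaces (lines through the origin) normal to $\chi_i(V_i)$ at its points. For a finite Borel measure $\mu$ on $\mathbb{R}^d$, a discrete set $\Lambda\subset\mathbb{R}^d$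 is a frame spectrum of $\mu$ if there are $0<A\le B<\infty$ with $$A\|f\|_{L^2(\mu)}^2\le\sum_{\lambda\in\Lambda}\Big|\int f(x)e^{-2\pi i x\cdot\lambda}\,d\mu(x)\Big|^2\le B\|f\|_{L^2(\mu)}^2\qquad\text{for all } f\in L^2(\mu),$$ and $\mu$ admits a Fourier frame if it has a frame spectrum. **Theorem.** Suppose $\sigma_S$ is finite. If $\Lambda$ is a frame spectrum of $\sigma_S$, then $\Lambda\cap(\mathbb{R}^d\setminus\mathcal{C}_{S'})\neq\emptyset$ for every submanifold $S'$ compactly contained in $S$. In particular, if there is such an $S'$ with $\mathcal{C}_{S'}=\mathbb{R}^d$, then $\sigma_S$ admits no Fourier frame. -/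

import Mathlib

open MeasureTheory
open scoped ContDiff NNReal ENNReal

noncomputable section

/-- A smooth embedding `χ : U → ℝᵈ` of an open set `U ⊆ ℝᵏ`: an injective immersion of class `C^∞`
that is a homeomorphism onto its image. Only the values of `χ` on `U` matter. -/
structure IsSmoothPatch {k d : ℕ} (U : Set (EuclideanSpace ℝ (Fin k)))
    (χ : EuclideanSpace ℝ (Fin k) → EuclideanSpace ℝ (Fin d)) : Prop where
  isOpen : IsOpen U
  contDiffOn : ContDiffOn ℝ ∞ χ U
  injective_fderiv : ∀ x ∈ U, Function.Injective (fderiv ℝ χ x)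
  isEmbedding : Topology.IsEmbedding (U.domRestrict χ)

/-- The tangent space of the patch `χ` at `χ x`. -/
def patchTangent {k d : ℕ} (χ : EuclideanSpace ℝ (Fin k) → EuclideanSpace ℝ (Fin d))
    (x : EuclideanSpace ℝ (Fin k)) : Submodule ℝ (EuclideanSpace ℝ (Fin d)) :=
  LinearMap.range (fderiv ℝ χ x).toLinearMap

/-- The normal space of the patch `χ` at `χ x`. For a hypersurface patch (`k = d - 1`) this is
the one-dimensional linear subspace along the normal. -/
def patchNormal {k d : ℕ} (χ : EuclideanSpace ℝ (Fin k) → EuclideanSpace ℝ (Fin d))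
    (x : EuclideanSpace ℝ (Fin k)) : Submodule ℝ (EuclideanSpace ℝ (Fin d)) :=
  (patchTangent χ x)ᗮ

/-- The matrix `⟪∂ᵢχ, ∂ⱼχ⟫` of the first fundamental form at `x`. -/
def firstForm {k d : ℕ} (χ : EuclideanSpace ℝ (Fin k) → EuclideanSpace ℝ (Fin d))
    (x : EuclideanSpace ℝ (Fin k)) : Matrix (Fin k) (Fin k) ℝ :=
  Matrix.of fun i j => inner ℝ (fderiv ℝ χ x (EuclideanSpace.single i 1))
    (fderiv ℝ χ x (EuclideanSpace.single j 1))

/-- The matrix `⟪∂ᵢ∂ⱼχ, ν⟫` of the second fundamental form at `x`, for the unit normal `ν`. -/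
def secondForm {k d : ℕ} (χ : EuclideanSpace ℝ (Fin k) → EuclideanSpace ℝ (Fin d))
    (x : EuclideanSpace ℝ (Fin k)) (ν : EuclideanSpace ℝ (Fin d)) : Matrix (Fin k) (Fin k) ℝ :=
  Matrix.of fun i j => inner ℝ (fderiv ℝ (fderiv ℝ χ) x (EuclideanSpace.single i 1)
    (EuclideanSpace.single j 1)) ν

/-- The Gaussian (Gauss–Kronecker) curvature `det II / det I` of a hypersurface patch at `χ x`,
the sign being fixed by the choice of the unit normal `ν`. -/
def gaussianCurvature {k d : ℕ} (χ : EuclideanSpace ℝ (Fin k) → EuclideanSpace ℝ (Fin d))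
    (x : EuclideanSpace ℝ (Fin k)) (ν : EuclideanSpace ℝ (Fin d)) : ℝ :=
  (secondForm χ x ν).det / (firstForm χ x).det

/-- The patch `χ (U)` has nonvanishing Gaussian curvature, at every point and for either choice of
the unit normal (the two choices change the curvature by a sign only). -/
def HasNonvanishingCurvature {k d : ℕ} (U : Set (EuclideanSpace ℝ (Fin k)))
    (χ : EuclideanSpace ℝ (Fin k) → EuclideanSpace ℝ (Fin d)) : Prop :=
  ∀ x ∈ U, ∀ ν ∈ patchNormal χ x, ‖ν‖ = 1 → gaussianCurvature χ x ν ≠ 0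

/-- The surface measure of the patch `χ (U)`: the push-forward under `χ` of
`√(det ⟪∂ᵢχ, ∂ⱼχ⟫) dx` on `U`. -/
def patchMeasure {k d : ℕ} (U : Set (EuclideanSpace ℝ (Fin k)))
    (χ : EuclideanSpace ℝ (Fin k) → EuclideanSpace ℝ (Fin d)) :
    Measure (EuclideanSpace ℝ (Fin d)) :=
  ((volume.restrict U).withDensity
    fun x => ENNReal.ofReal (Real.sqrt (firstForm χ x).det)).map χ

/-- The multiplicity `m(p) = #{i : p ∈ χᵢ(Uᵢ)}`. -/
def patchMultiplicity {k d M : ℕ} (U : Fin M → Set (EuclideanSpace ℝ (Fin k)))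
    (χ : Fin M → EuclideanSpace ℝ (Fin k) → EuclideanSpace ℝ (Fin d))
    (p : EuclideanSpace ℝ (Fin d)) : ℕ :=
  Set.ncard {i : Fin M | p ∈ χ i '' U i}

/-- The multiplicity-normalized surface measure `dσ_S = ∑ᵢ m(p)⁻¹ dσᵢ` of `S = ⋃ᵢ χᵢ(Uᵢ)`. -/
def surfaceMeasure {k d M : ℕ} (U : Fin M → Set (EuclideanSpace ℝ (Fin k)))
    (χ : Fin M → EuclideanSpace ℝ (Fin k) → EuclideanSpace ℝ (Fin d)) :
    Measure (EuclideanSpace ℝ (Fin d)) :=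
  ∑ i, (patchMeasure (U i) (χ i)).withDensity
    fun p => (patchMultiplicity U χ p : ℝ≥0∞)⁻¹

/-- The family `V` of parameter domains describes a submanifold `S' = ⋃ᵢ χᵢ(Vᵢ)` compactly
contained in `S = ⋃ᵢ χᵢ(Uᵢ)`. Some or all of the `Vᵢ` may be empty. -/
def IsCompactlyContained {k M : ℕ} (V U : Fin M → Set (EuclideanSpace ℝ (Fin k))) : Prop :=
  ∀ i, IsOpen (V i) ∧ IsCompact (closure (V i)) ∧ closure (V i) ⊆ U i

/-- The union of the normal lines of `⋃ᵢ χᵢ(Vᵢ)`, all taken through the origin. -/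
def normalLines {k d M : ℕ} (V : Fin M → Set (EuclideanSpace ℝ (Fin k)))
    (χ : Fin M → EuclideanSpace ℝ (Fin k) → EuclideanSpace ℝ (Fin d)) :
    Set (EuclideanSpace ℝ (Fin d)) :=
  ⋃ i, ⋃ x ∈ V i, (patchNormal (χ i) x : Set (EuclideanSpace ℝ (Fin d)))

/-- The Fourier transform `∫ f(x) exp(-2πi⟨x, ξ⟩) dμ(x)` of the complex measure `f dμ`. -/
def fourierOfDensity {d : ℕ} (μ : Measure (EuclideanSpace ℝ (Fin d)))
    (f : EuclideanSpace ℝ (Fin d) → ℂ) (ξ : EuclideanSpace ℝ (Fin d)) : ℂ :=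
  ∫ x, Complex.exp (-(2 * Real.pi * inner ℝ x ξ : ℝ) * Complex.I) * f x ∂μ

/-- `Λ` is a frame spectrum of `μ` (meant for finite `μ`): it is discrete, and there are
`0 < A ≤ B < ∞` with `A ‖f‖² ≤ ∑_{λ ∈ Λ} |(f dμ)^(λ)|² ≤ B ‖f‖²` for all `f ∈ L²(μ)`. -/
def IsFrameSpectrum {d : ℕ} (μ : Measure (EuclideanSpace ℝ (Fin d)))
    (Λ : Set (EuclideanSpace ℝ (Fin d))) : Prop :=
  DiscreteTopology Λ ∧ ∃ A B : ℝ≥0, 0 < A ∧ A ≤ B ∧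
    ∀ f : EuclideanSpace ℝ (Fin d) → ℂ, MemLp f 2 μ →
      A * (∫⁻ x, ‖f x‖ₑ ^ 2 ∂μ) ≤ ∑' l : Λ, ‖fourierOfDensity μ f l‖ₑ ^ 2 ∧
      ∑' l : Λ, ‖fourierOfDensity μ f l‖ₑ ^ 2 ≤ B * (∫⁻ x, ‖f x‖ₑ ^ 2 ∂μ)

/-- `μ` admits a Fourier frame. -/
def AdmitsFourierFrame {d : ℕ} (μ : Measure (EuclideanSpace ℝ (Fin d))) : Prop :=
  ∃ Λ, IsFrameSpectrum μ Λ

end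

/-! Put `k = d - 1` and suppose that a frame spectrum `Λ` lies in the union of the normal lines of
`S'`. Let `F` be the Fourier transform of a smooth amplitude on a small piece of one patch. That
piece of measure has a bounded density with respect to `σ_S`, and modulating the density translates
`F`. The frame inequalities therefore give `0 < a ≤ ∑ |F(λ - η)|² ≤ b < ∞` with constants
independent of `η` (`IsFrameSpectrum.exists_le_tsum_surfaceFourier_le`).

Curvature makes `|F(ξ)|²` comparable to `|ξ|⁻ᵏ` near the normal direction at the centre of the
piece. The upper frame bound then makes `(1 + |λ|)⁻ᵏ` summable over the part of `Λ` far out in a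
cone around that normal. The unit normals over the closures of the `Vᵢ` are compact, so finitely
many cones suffice; translates of `F` handle bounded sets. Hence `∑ (1 + |λ|)⁻ᵏ < ∞` over all of `Λ`
(`IsFrameSpectrum.weightSummableOn_of_subset_normalLines`).

On the other hand `|F|² ≤ C (1 + |·|)⁻ᵏ` everywhere. Averaging the lower frame bound over `|η| < R`
bounds `a` by a sum whose terms tend to zero as `R → ∞`, because `k ≥ 1`, and are dominated by a
constant times `(1 + |λ|)⁻ᵏ`. So `a = 0`, a contradiction (`eq_zero_of_forall_le_tsum_enorm_sq`).

The estimates on `F` need no stationary phase expansion. `|F(tη)|²` is the integral over `h` of an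
autocorrelation whose phase, for `h ≠ 0`, has no critical point when the Hessian is nondegenerate.
Nonstationary phase bounds it by powers of `(1 + t|h|)⁻¹`; the substitution `h = u / t` and
dominated convergence give the upper bound and a limit of `tᵏ |F(tη)|²`. A Gaussian regularization
shows that this limit is not zero. -/

/-! ### Nonstationary phase with constants uniform over a family. -/

section UniformlySmooth

open Filter Topology

variable {ι E F G : Type*} [NormedAddCommGroup E] [NormedSpace ℝ E] [NormedAddCommGroup F]
  [NormedSpace ℝ F] [NormedAddCommGroup G] [NormedSpace ℝ G]

/-- A family of smooth functions each of whose derivatives is bounded uniformly in the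
family. -/
def UniformlySmooth (f : ι → E → F) : Prop :=
  (∀ i, ContDiff ℝ ∞ (f i)) ∧ ∀ k : ℕ, ∃ C : ℝ, ∀ i x, ‖iteratedFDeriv ℝ k (f i) x‖ ≤ C

namespace UniformlySmooth

theorem exists_norm_le {f : ι → E → F} (hf : UniformlySmooth f) : ∃ C : ℝ, 0 ≤ C ∧
    ∀ i x, ‖f i x‖ ≤ C := by
  obtain ⟨C, hC⟩ := hf.2 0
  refine ⟨max C 0, le_max_right _ _, fun i x => le_max_of_le_left ?_⟩
  simpa using hC i x

theorem reindex {κ : Type*} {f : ι → E → F} (hf : UniformlySmooth f) (r : κ → ι) :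
    UniformlySmooth fun j => f (r j) :=
  ⟨fun j => hf.1 (r j), fun k => (hf.2 k).imp fun _ hC j => hC (r j)⟩

theorem of_hasCompactSupport {f : E → F} (hf : ContDiff ℝ ∞ f) (hc : HasCompactSupport f) :
    UniformlySmooth fun _ : ι => f := by
  refine ⟨fun _ => hf, fun k => ?_⟩
  obtain ⟨C, hC⟩ := (hc.iteratedFDeriv k).exists_bound_of_continuous
    (hf.continuous_iteratedFDeriv (mod_cast le_top))
  exact ⟨C, fun _ => hC⟩

theorem mul {f g : ι → E → ℝ} (hf : UniformlySmooth f) (hg : UniformlySmooth g) :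
    UniformlySmooth fun i x => f i x * g i x := by
  refine ⟨fun i => (hf.1 i).mul (hg.1 i), fun k => ?_⟩
  choose A hA using hf.2
  choose B hB using hg.2
  refine ⟨∑ j ∈ Finset.range (k + 1), (k.choose j : ℝ) * A j * B (k - j), fun i x => ?_⟩
  refine (norm_iteratedFDeriv_mul_le (hf.1 i) (hg.1 i) x (n := k) (mod_cast le_top)).trans ?_
  refine Finset.sum_le_sum fun j _ => ?_
  have h0 : 0 ≤ A j := (norm_nonneg _).trans (hA j i x)
  gcongr
  · exact hA j i x
  · exact hB _ i x

theorem fderiv {f : ι → E → F} (hf : UniformlySmooth f) :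
    UniformlySmooth fun i => fderiv ℝ (f i) :=
  ⟨fun i => (hf.1 i).fderiv_right (m := ∞) (by simp),
    fun k => (hf.2 (k + 1)).imp fun C hC i x => by
      rw [norm_iteratedFDeriv_fderiv]; exact hC i x⟩

theorem clm_comp {f : ι → E → F} (hf : UniformlySmooth f) {L : ι → F →L[ℝ] G} {D : ℝ}
    (hL : ∀ i, ‖L i‖ ≤ D) : UniformlySmooth fun i x => L i (f i x) := by
  refine ⟨fun i => (L i).contDiff.comp (hf.1 i), fun k => ?_⟩
  obtain ⟨C, hC⟩ := hf.2 k
  refine ⟨D * C, fun i x => ?_⟩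
  refine ((L i).norm_iteratedFDeriv_comp_left (hf.1 i).contDiffAt (n := k)
    (mod_cast le_top)).trans ?_
  exact mul_le_mul (hL i) (hC i x) (norm_nonneg _) ((norm_nonneg _).trans (hL i))

theorem fderiv_apply {f : ι → E → F} (hf : UniformlySmooth f) {v : ι → E}
    (hv : ∀ i, ‖v i‖ ≤ 1) : UniformlySmooth fun i x => _root_.fderiv ℝ (f i) x (v i) := by
  refine hf.fderiv.clm_comp (L := fun i => ContinuousLinearMap.apply ℝ F (v i)) (D := 1)
    fun i => ?_
  refine ContinuousLinearMap.opNorm_le_bound _ zero_le_one fun T => ?_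
  simp only [ContinuousLinearMap.apply_apply, one_mul]
  exact T.le_of_opNorm_le_of_le le_rfl (hv i) |>.trans (by simp)

/-- No global bound on `ρ` is needed: all the `f i` take values in one closed ball, which is
compact, so each derivative of `ρ` is bounded there. -/
theorem comp [FiniteDimensional ℝ F] {ρ : F → G} (hρ : ContDiff ℝ ∞ ρ) {f : ι → E → F}
    (hf : UniformlySmooth f) : UniformlySmooth fun i x => ρ (f i x) := by
  refine ⟨fun i => hρ.comp (hf.1 i), fun k => ?_⟩
  obtain ⟨R, -, hR⟩ := hf.exists_norm_le
  choose B hB using hf.2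
  have hA : ∀ j : ℕ, ∃ A : ℝ, 0 ≤ A ∧
      ∀ y ∈ Metric.closedBall (0 : F) R, ‖iteratedFDeriv ℝ j ρ y‖ ≤ A := fun j => by
    obtain ⟨A, hA⟩ := (isCompact_closedBall (0 : F) R).exists_bound_of_continuousOn
      (hρ.continuous_iteratedFDeriv (m := j) (mod_cast le_top)).continuousOn
    exact ⟨max A 0, le_max_right _ _, fun y hy => le_max_of_le_left (hA y hy)⟩
  choose A hA0 hA using hA
  -- The bound on derivatives of a composite asks for `D ^ j` at order `j`; taking `D ≥ 1` lets a
  -- single constant serve all orders.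
  set D : ℝ := 1 + ∑ j ∈ Finset.range (k + 1), |B j|
  have hD1 : 1 ≤ D := le_add_of_nonneg_right (Finset.sum_nonneg fun _ _ => abs_nonneg _)
  refine ⟨k.factorial * (∑ j ∈ Finset.range (k + 1), A j) * D ^ k, fun i x => ?_⟩
  refine norm_iteratedFDeriv_comp_le hρ (hf.1 i) (mod_cast le_top) x (fun j hj => ?_)
    fun j hj hjk => ?_
  · refine (hA j _ (by simpa using hR i x)).trans ?_
    exact Finset.single_le_sum (f := A) (fun j _ => hA0 j) (Finset.mem_range.2 (by omega))
  · calc ‖iteratedFDeriv ℝ j (f i) x‖ ≤ |B j| := (hB j i x).trans (le_abs_self _)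
      _ ≤ ∑ j ∈ Finset.range (k + 1), |B j| :=
        Finset.single_le_sum (f := fun j => |B j|) (fun j _ => abs_nonneg _)
          (Finset.mem_range.2 (by omega))
      _ ≤ D := by simp [D]
      _ ≤ D ^ j := le_self_pow₀ hD1 (by omega)

theorem comp_add_right {f : ι → E → F} (hf : UniformlySmooth f) (h : ι → E) :
    UniformlySmooth fun i x => f i (x + h i) :=
  ⟨fun i => (hf.1 i).comp (contDiff_id.add contDiff_const), fun k =>
    (hf.2 k).imp fun C hC i x => by
      rw [iteratedFDeriv_comp_add_right]; exact hC i _⟩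

/-- By the mean value inequality, a bound on the derivative of order `k + 1` controls the quotient
at order `k`, with no loss as `h i → 0`. This keeps phases divided by `‖h‖` uniformly smooth. -/
theorem diffQuotient {f : ι → E → F} (hf : UniformlySmooth f) (h : ι → E) :
    UniformlySmooth fun i x => ‖h i‖⁻¹ • (f i (x + h i) - f i x) := by
  have hs : ∀ i, ContDiff ℝ ∞ fun x => f i (x + h i) := (hf.comp_add_right h).1
  refine ⟨fun i => ((hs i).sub (hf.1 i)).const_smul _, fun k => ?_⟩
  obtain ⟨C, hC⟩ := hf.2 (k + 1)
  refine ⟨max C 0, fun i x => ?_⟩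
  have e : iteratedFDeriv ℝ k (fun x => ‖h i‖⁻¹ • (f i (x + h i) - f i x)) x =
      ‖h i‖⁻¹ • (iteratedFDeriv ℝ k (f i) (x + h i) - iteratedFDeriv ℝ k (f i) x) := by
    rw [iteratedFDeriv_const_smul_apply', fun_iteratedFDeriv_sub_apply,
      iteratedFDeriv_comp_add_right]
    · exact ((hs i).of_le (mod_cast le_top)).contDiffAt
    · exact ((hf.1 i).of_le (mod_cast le_top)).contDiffAt
    · exact (((hs i).sub (hf.1 i)).of_le (mod_cast le_top)).contDiffAt
  have hb : ‖iteratedFDeriv ℝ k (f i) (x + h i) - iteratedFDeriv ℝ k (f i) x‖ ≤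
      C * ‖x + h i - x‖ := by
    refine convex_univ.norm_image_sub_le_of_norm_fderiv_le (𝕜 := ℝ) (fun y _ => ?_)
      (fun y _ => ?_) (Set.mem_univ _) (Set.mem_univ _)
    · exact ((hf.1 i).differentiable_iteratedFDeriv (m := k)
        (mod_cast WithTop.coe_lt_top _)).differentiableAt
    · rw [norm_fderiv_iteratedFDeriv]; exact hC i y
  rw [e, norm_smul, norm_inv, norm_norm]
  rw [add_sub_cancel_left] at hb
  rcases eq_or_ne (h i) 0 with h0 | h0
  · simp [h0]
  · have hp : 0 < ‖h i‖ := norm_pos_iff.2 h0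
    rw [inv_mul_le_iff₀ hp, mul_comm]
    exact hb.trans (by gcongr; exact le_max_left _ _)

end UniformlySmooth

/-- A smooth function on the line that agrees with `s ↦ s⁻¹` on `[c, ∞)`. -/
theorem exists_contDiff_mul_eq_one {c : ℝ} (hc : 0 < c) :
    ∃ ρ : ℝ → ℝ, ContDiff ℝ ∞ ρ ∧ ∀ s, c ≤ s → ρ s * s = 1 := by
  -- The cutoff vanishes for `s ≤ c / 2`, which removes the singularity at zero, and equals one for
  -- `s ≥ c`.
  refine ⟨fun s => Real.smoothTransition (2 * s / c - 1) * s⁻¹, ?_, fun s hs => ?_⟩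
  · refine contDiff_iff_contDiffAt.2 fun s => ?_
    rcases eq_or_ne s 0 with rfl | hs
    · refine ContDiffAt.congr_of_eventuallyEq (f := fun _ => (0 : ℝ)) contDiffAt_const ?_
      filter_upwards [gt_mem_nhds (show (0 : ℝ) < c / 2 by positivity)] with s hs
      rw [Real.smoothTransition.zero_of_nonpos, zero_mul]
      rw [sub_nonpos, div_le_one hc]; linarith
    · refine ContDiffAt.mul ?_ (contDiffAt_id.inv hs)
      refine (Real.smoothTransition.contDiff.comp ?_).contDiffAt
      exact ((contDiff_const.mul contDiff_id).div_const _).sub contDiff_const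
  · have hs0 : s ≠ 0 := (hc.trans_le hs).ne'
    beta_reduce
    rw [Real.smoothTransition.one_of_one_le, one_mul, inv_mul_cancel₀ hs0]
    rw [le_sub_iff_add_le, le_div_iff₀ hc]; linarith

/-- Nonstationary phase, uniformly over a family: if the phases `ψ i` increase at rate at least `c`
in the direction `v i` on the support of the amplitude, then the oscillatory integrals decay faster
than any power of the frequency. -/
theorem UniformlySmooth.exists_pow_mul_norm_integral_le [FiniteDimensional ℝ E]
    [MeasurableSpace E] [BorelSpace E] (μ : Measure E) [μ.IsAddHaarMeasure]
    {ψ : ι → E → ℝ} {v : ι → E} (hψ : ∀ i, ContDiff ℝ ∞ (ψ i)) (hv : ∀ i, ‖v i‖ ≤ 1)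
    (hp : UniformlySmooth fun i x => _root_.fderiv ℝ (ψ i) x (v i)) {c : ℝ} (hc : 0 < c)
    {K : Set E} (hK : IsCompact K) (N : ℕ) {b : ι → E → ℝ} (hb : UniformlySmooth b)
    (hbK : ∀ i, tsupport (b i) ⊆ K)
    (hbc : ∀ i, ∀ x ∈ tsupport (b i), c ≤ _root_.fderiv ℝ (ψ i) x (v i)) :
    ∃ C : ℝ, 0 ≤ C ∧ ∀ i, ∀ τ : ℝ, 0 < τ →
      τ ^ N * ‖∫ x, b i x • Complex.exp ((τ * ψ i x : ℝ) * Complex.I) ∂μ‖ ≤ C := by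
  induction N generalizing b with
  | zero =>
    obtain ⟨C, hC0, hC⟩ := hb.exists_norm_le
    refine ⟨C * μ.real K, by positivity, fun i τ _ => ?_⟩
    rw [pow_zero, one_mul, ← setIntegral_eq_integral_of_forall_compl_eq_zero (s := K)]
    · refine norm_setIntegral_le_of_norm_le_const hK.measure_lt_top fun x _ => ?_
      rw [norm_smul, Complex.norm_exp_ofReal_mul_I, mul_one]
      exact hC i x
    · intro x hx
      rw [image_eq_zero_of_notMem_tsupport fun h => hx (hbK i h), zero_smul]
  | succ N ih =>
    -- Dividing the amplitude by the directional derivative of the phase prepares an integration by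
    -- parts; `ρ` performs the division smoothly also off the support of `b i`.
    obtain ⟨ρ, hρ, hρ1⟩ := exists_contDiff_mul_eq_one hc
    set q : ι → E → ℝ := fun i x => b i x * ρ (_root_.fderiv ℝ (ψ i) x (v i))
    have hq : UniformlySmooth q := hb.mul (hp.comp hρ)
    have hqb : ∀ i, tsupport (q i) ⊆ tsupport (b i) := fun i => tsupport_mul_subset_left
    have hdq : ∀ i, tsupport (fun x => _root_.fderiv ℝ (q i) x (v i)) ⊆ tsupport (b i) :=
      fun i => (tsupport_fderiv_apply_subset ℝ (v i)).trans (hqb i)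
    obtain ⟨C, hC0, hC⟩ := ih (hq.fderiv_apply hv) (fun i => (hdq i).trans (hbK i))
      fun i x hx => hbc i x (hdq i hx)
    refine ⟨C, hC0, fun i τ hτ => ?_⟩
    refine le_trans (le_of_eq ?_) (hC i τ hτ)
    set e : E → ℂ := fun x => Complex.exp ((τ * ψ i x : ℝ) * Complex.I)
    have he : ContDiff ℝ ∞ e :=
      Complex.contDiff_exp.comp
        ((Complex.ofRealCLM.contDiff.comp (contDiff_const.mul (hψ i))).mul contDiff_const)
    have hde : ∀ x, _root_.fderiv ℝ e x (v i) =
        (τ * _root_.fderiv ℝ (ψ i) x (v i)) • (Complex.I * e x) := fun x => by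
      have h1 : HasFDerivAt (fun x => (((τ * ψ i x : ℝ) : ℂ) * Complex.I))
          ((Complex.I) • (Complex.ofRealCLM.comp (τ • _root_.fderiv ℝ (ψ i) x))) x :=
        (Complex.ofRealCLM.hasFDerivAt.comp x
          ((((hψ i).differentiable (by simp)).differentiableAt.hasFDerivAt).const_mul τ)).mul_const _
      rw [h1.cexp.fderiv]
      simp [e]
      ring
    have hcs : ∀ f : E → ℝ, Continuous f → tsupport f ⊆ tsupport (b i) → ∀ g : E → ℂ,
        Continuous g → Integrable (fun x => f x • g x) μ := fun f hf hfs g hg => by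
      refine (hf.smul hg).integrable_of_hasCompactSupport (HasCompactSupport.smul_right ?_)
      exact hK.of_isClosed_subset (isClosed_tsupport _) (hfs.trans (hbK i))
    have hqc := (hq.1 i).continuous
    have hdqc := ((hq.fderiv_apply hv).1 i).continuous
    have hdec : Continuous fun x => _root_.fderiv ℝ e x (v i) :=
      (he.continuous_fderiv (by simp)).clm_apply continuous_const
    -- Each integration by parts gains one factor `τ⁻¹` and replaces the amplitude by a derivative
    -- of `q`, again uniformly smooth.
    have key := integral_smul_fderiv_eq_neg_fderiv_smul_of_integrable (μ := μ) (v := v i)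
      (hcs _ hdqc (hdq i) e he.continuous) (hcs _ hqc (hqb i) _ hdec)
      (hcs _ hqc (hqb i) e he.continuous)
      (fun x _ => ((hq.1 i).differentiable (by simp)).differentiableAt)
      (fun x _ => (he.differentiable (by simp)).differentiableAt)
    have hlhs : ∀ x, q i x • _root_.fderiv ℝ e x (v i) = (τ * Complex.I) * (b i x • e x) := by
      intro x
      rw [hde]
      by_cases hx : x ∈ tsupport (b i)
      · have := hρ1 _ (hbc i x hx)
        have h2 : (ρ (_root_.fderiv ℝ (ψ i) x (v i)) : ℂ) * _root_.fderiv ℝ (ψ i) x (v i) = 1 := by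
          exact_mod_cast this
        simp only [q, Complex.real_smul]
        push_cast
        linear_combination (b i x * τ * Complex.I * e x : ℂ) * h2
      · simp [q, image_eq_zero_of_notMem_tsupport hx]
    simp_rw [hlhs, integral_const_mul] at key
    have hn := congrArg norm key
    rw [norm_neg, norm_mul, norm_mul, Complex.norm_I, mul_one, Complex.norm_real,
      Real.norm_of_nonneg hτ.le] at hn
    rw [← hn, pow_succ, mul_assoc]

end UniformlySmooth

/-! ### The squared Fourier transform as an integral of autocorrelations, and their decay. -/

section OscillatoryIntegral

open Filter Topology

theorem tsupport_mul_comp_add_subset {E : Type*} [NormedAddCommGroup E] (g : E → ℝ) (h : E) :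
    tsupport (fun y => g (y + h) * g y) ⊆ {y | y ∈ tsupport g ∧ y + h ∈ tsupport g} := by
  refine fun y hy => ⟨tsupport_mul_subset_right hy, ?_⟩
  exact tsupport_comp_subset_preimage g (f := fun y => y + h) (by fun_prop)
    (tsupport_mul_subset_left hy)

variable {E F : Type*} [NormedAddCommGroup E] [InnerProductSpace ℝ E] [FiniteDimensional ℝ E]
  [MeasurableSpace E] [BorelSpace E] [NormedAddCommGroup F] [InnerProductSpace ℝ F]

/-- The Fourier transform `∫ g(x) exp(-2πi⟨X x, ξ⟩) dx` of the density `g` carried by the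
parametrized surface `X`. -/
noncomputable def surfaceFourier (X : E → F) (g : E → ℝ) (ξ : F) : ℂ :=
  ∫ x, g x • Complex.exp ((-(2 * Real.pi * inner ℝ (X x) ξ) : ℝ) * Complex.I)

/-- The part of `|surfaceFourier X g ξ|²` that comes from pairs of parameters with
difference `h`. -/
noncomputable def surfaceAutocorrelation (X : E → F) (g : E → ℝ) (ξ : F) (h : E) : ℂ :=
  ∫ y, (g (y + h) * g y) •
    Complex.exp ((-(2 * Real.pi * inner ℝ (X (y + h) - X y) ξ) : ℝ) * Complex.I)

theorem norm_real_smul_exp_ofReal_mul_I (a t : ℝ) :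
    ‖a • Complex.exp (t * Complex.I)‖ = |a| := by
  rw [norm_smul, Complex.norm_exp_ofReal_mul_I, mul_one, Real.norm_eq_abs]

/-- Expand `F` times its conjugate as a double integral, substitute `x = y + h`, and exchange the
integrals. -/
theorem sq_norm_surfaceFourier {X : E → F} (hX : Continuous X) {g : E → ℝ} (hg : Continuous g)
    (hgc : HasCompactSupport g) (ξ : F) :
    ‖surfaceFourier X g ξ‖ ^ 2 = ‖∫ h, surfaceAutocorrelation X g ξ h‖ := by
  set f : E → ℂ := fun x =>
    g x • Complex.exp ((-(2 * Real.pi * inner ℝ (X x) ξ) : ℝ) * Complex.I) with hfdef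
  have hf : Continuous f := by fun_prop
  have hfc : HasCompactSupport f := hgc.smul_right
  have key : surfaceFourier X g ξ * (starRingEnd ℂ) (surfaceFourier X g ξ) =
      ∫ h, surfaceAutocorrelation X g ξ h := by
    calc surfaceFourier X g ξ * (starRingEnd ℂ) (surfaceFourier X g ξ)
        = ∫ y, (∫ x, f x) * (starRingEnd ℂ) (f y) := by
          rw [integral_const_mul, integral_conj]; rfl
      _ = ∫ y, ∫ h, f (y + h) * (starRingEnd ℂ) (f y) := by
          refine integral_congr_ae (Eventually.of_forall fun y => ?_)
          simp only
          rw [integral_mul_const, integral_add_left_eq_self f y]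
      _ = ∫ h, ∫ y, f (y + h) * (starRingEnd ℂ) (f y) := by
          refine integral_integral_swap_of_hasCompactSupport ?_ ?_
          · exact (hf.comp (continuous_fst.add continuous_snd)).mul
              (Complex.continuous_conj.comp (hf.comp continuous_fst))
          · refine HasCompactSupport.intro
              ((hfc.isCompact.prod hfc.isCompact).image (f := fun q : E × E => (q.1, q.2 - q.1))
                (by fun_prop)) fun p hp => ?_
            by_contra hne
            simp only [Function.uncurry, mul_eq_zero, map_eq_zero, not_or] at hne
            exact hp ⟨(p.1, p.1 + p.2), ⟨subset_tsupport _ hne.2, subset_tsupport _ hne.1⟩, by simp⟩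
      _ = _ := by
          refine integral_congr_ae (Eventually.of_forall fun h => ?_)
          refine integral_congr_ae (Eventually.of_forall fun y => ?_)
          simp only [hfdef, Complex.real_smul, map_mul, Complex.conj_ofReal, ← Complex.exp_conj,
            Complex.conj_I]
          rw [mul_mul_mul_comm, ← Complex.exp_add, inner_sub_left]
          push_cast
          congr 2
          ring
  rw [← key, norm_mul, RCLike.norm_conj, sq]

/-- The gradients of the phases `⟨X, η⟩`, `η ∈ Ω`, at two points of `W` differ by at least `c` times
the distance of the points, as witnessed by a direction that depends only on their difference. -/
def SeparatesGradients (X : E → F) (Ω : Set F) (W : Set E) (c : ℝ) : Prop :=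
  ∀ η ∈ Ω, ∀ h : E, ∃ v : E, ‖v‖ ≤ 1 ∧ ∀ y ∈ W, y + h ∈ W →
    c * ‖h‖ ≤ inner ℝ (fderiv ℝ X y v - fderiv ℝ X (y + h) v) η

theorem exists_norm_surfaceAutocorrelation_le {g : E → ℝ} (hg : Continuous g)
    (hgc : HasCompactSupport g) :
    ∃ B : ℝ, ∀ (X : E → F) (ξ : F) (h : E), ‖surfaceAutocorrelation X g ξ h‖ ≤ B := by
  obtain ⟨C, hC⟩ := hgc.exists_bound_of_continuous hg
  refine ⟨∫ y, C * |g y|, fun X ξ h => ?_⟩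
  refine norm_integral_le_of_norm_le
    ((hg.abs.integrable_of_hasCompactSupport hgc.abs).const_mul C)
    (Eventually.of_forall fun y => ?_)
  rw [norm_real_smul_exp_ofReal_mul_I, abs_mul]
  gcongr
  exact hC _

/-- With the phase divided by `‖h‖`, separation of gradients becomes a lower bound `c` on a
directional derivative, uniform in `h`; the effective frequency is then `2πt‖h‖`. -/
theorem SeparatesGradients.exists_pow_mul_norm_surfaceAutocorrelation_le {X : E → F}
    (hX : ContDiff ℝ ∞ X) (hXc : HasCompactSupport X) {Ω : Set F} {D : ℝ} (hΩ : ∀ η ∈ Ω, ‖η‖ ≤ D)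
    {W : Set E} {c : ℝ} (hc : 0 < c) (hS : SeparatesGradients X Ω W c) {g : E → ℝ}
    (hg : ContDiff ℝ ∞ g) (hgc : HasCompactSupport g) (hgW : tsupport g ⊆ W) (N : ℕ) :
    ∃ C : ℝ, 0 ≤ C ∧ ∀ η ∈ Ω, ∀ t : ℝ, 0 < t → ∀ h : E,
      (t * ‖h‖) ^ N * ‖surfaceAutocorrelation X g (t • η) h‖ ≤ C := by
  obtain ⟨B, hB⟩ := exists_norm_surfaceAutocorrelation_le (F := F) hg.continuous hgc
  replace hB := hB X
  choose! v hv1 hv using hS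
  let ι := {p : F × E // p.1 ∈ Ω}
  have hXU : UniformlySmooth fun _ : ι => X := .of_hasCompactSupport hX hXc
  have hgU : UniformlySmooth fun _ : ι => g := .of_hasCompactSupport hg hgc
  have hv1' : ∀ i : ι, ‖v i.1.1 i.1.2‖ ≤ 1 := fun i => hv1 _ i.2 _
  have hdX : ∀ x, HasFDerivAt X (fderiv ℝ X x) x := fun x =>
    (hX.differentiable (by simp)).differentiableAt.hasFDerivAt
  set ψ : ι → E → ℝ := fun i y => ‖i.1.2‖⁻¹ * inner ℝ (X y - X (y + i.1.2)) i.1.1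
  have hψ : ∀ i, ContDiff ℝ ∞ (ψ i) := fun i =>
    contDiff_const.mul ((hX.sub (hX.comp (contDiff_id.add contDiff_const))).inner ℝ contDiff_const)
  have hdψ : ∀ i y w, fderiv ℝ (ψ i) y w =
      ‖i.1.2‖⁻¹ * inner ℝ (fderiv ℝ X y w - fderiv ℝ X (y + i.1.2) w) i.1.1 := fun i y w => by
    have h2 : HasFDerivAt (fun y => X (y + i.1.2)) (fderiv ℝ X (y + i.1.2)) y := by
      simpa [Function.comp_def] using (hdX (y + i.1.2)).comp y ((hasFDerivAt_id y).add_const i.1.2)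
    have h1 := (((hdX y).sub h2).inner ℝ (hasFDerivAt_const i.1.1 y)).const_mul ‖i.1.2‖⁻¹
    rw [show fderiv ℝ (ψ i) y = _ from h1.fderiv]
    simp
  have hp : UniformlySmooth fun i y => fderiv ℝ (ψ i) y (v i.1.1 i.1.2) := by
    have h1 := ((hXU.fderiv_apply hv1').clm_comp (L := fun i : ι => -innerSL ℝ i.1.1) (D := D)
      fun i => by rw [norm_neg, innerSL_apply_norm]; exact hΩ _ i.2).diffQuotient fun i => i.1.2
    convert h1 using 3 with i y
    rw [hdψ, inner_sub_left]
    simp [real_inner_comm]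
    left
    ring
  obtain ⟨C, hC0, hC⟩ := UniformlySmooth.exists_pow_mul_norm_integral_le (ι := {i : ι // i.1.2 ≠ 0})
    volume
    (fun i => hψ i.1) (fun i => hv1' i.1) (hp.reindex Subtype.val) hc hgc.isCompact N
    (b := fun i y => g (y + i.1.1.2) * g y)
    (((hgU.comp_add_right fun i => i.1.2).mul hgU).reindex Subtype.val)
    (fun i y hy => (tsupport_mul_comp_add_subset g _ hy).1)
    (fun i y hy => by
      obtain ⟨h1, h2⟩ := tsupport_mul_comp_add_subset g _ hy
      rw [hdψ, ← div_eq_inv_mul, le_div_iff₀ (norm_pos_iff.2 i.2)]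
      exact hv _ i.1.2 _ y (hgW h1) (hgW h2))
  -- At `h = 0`, excluded from the oscillatory family, the left side vanishes unless `N = 0`, when
  -- the trivial bound `B` is needed.
  refine ⟨max C (if N = 0 then B else 0), le_max_of_le_left hC0, fun η hη t ht h => ?_⟩
  rcases eq_or_ne h 0 with rfl | h0
  · refine le_max_of_le_right ?_
    split_ifs with hN
    · subst hN; simpa using hB (t • η) 0
    · simp [hN]
  refine le_max_of_le_left ?_
  have hh : 0 < ‖h‖ := norm_pos_iff.2 h0
  refine le_trans ?_ (hC ⟨⟨(η, h), hη⟩, h0⟩ (2 * Real.pi * t * ‖h‖) (by positivity))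
  refine mul_le_mul (pow_le_pow_left₀ (by positivity) ?_ N) (le_of_eq ?_) (norm_nonneg _)
    (by positivity)
  · have : 1 ≤ 2 * Real.pi := by linarith [Real.two_le_pi]
    nlinarith [mul_pos ht hh]
  · rw [surfaceAutocorrelation]
    congr 2
    ext y
    congr 4
    simp only [ψ]
    rw [inner_smul_right, ← neg_sub (X (y + h)), inner_neg_left]
    field_simp

theorem SeparatesGradients.exists_one_add_pow_mul_norm_surfaceAutocorrelation_le {X : E → F}
    (hX : ContDiff ℝ ∞ X) (hXc : HasCompactSupport X) {Ω : Set F} {D : ℝ} (hΩ : ∀ η ∈ Ω, ‖η‖ ≤ D)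
    {W : Set E} {c : ℝ} (hc : 0 < c) (hS : SeparatesGradients X Ω W c) {g : E → ℝ}
    (hg : ContDiff ℝ ∞ g) (hgc : HasCompactSupport g) (hgW : tsupport g ⊆ W) (N : ℕ) :
    ∃ C : ℝ, 0 ≤ C ∧ ∀ η ∈ Ω, ∀ t : ℝ, 0 < t → ∀ h : E,
      (1 + t * ‖h‖) ^ N * ‖surfaceAutocorrelation X g (t • η) h‖ ≤ C := by
  obtain ⟨C, hC0, hC⟩ :=
    hS.exists_pow_mul_norm_surfaceAutocorrelation_le hX hXc hΩ hc hg hgc hgW N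
  obtain ⟨B, hB⟩ := exists_norm_surfaceAutocorrelation_le (F := F) hg.continuous hgc
  have hB0 : 0 ≤ B := (norm_nonneg _).trans (hB X 0 0)
  refine ⟨2 ^ (N - 1) * (B + C), by positivity, fun η hη t ht h => ?_⟩
  have h1 := add_pow_le zero_le_one (mul_nonneg ht.le (norm_nonneg h)) N
  rw [one_pow] at h1
  refine (mul_le_mul_of_nonneg_right h1 (norm_nonneg _)).trans ?_
  rw [mul_assoc, add_mul, one_mul]
  gcongr
  exacts [hB _ _ _, hC η hη t ht h]

end OscillatoryIntegral

/-! ### Size of the Fourier transform near a normal direction. -/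

section OscillatoryIntegralAsymptotics

open Filter Topology

variable {E F : Type*} [NormedAddCommGroup E] [InnerProductSpace ℝ E] [FiniteDimensional ℝ E]
  [MeasurableSpace E] [BorelSpace E] [NormedAddCommGroup F] [InnerProductSpace ℝ F]

theorem pow_mul_sq_norm_surfaceFourier {X : E → F} (hX : Continuous X) {g : E → ℝ}
    (hg : Continuous g) (hgc : HasCompactSupport g) (ξ : F) {t : ℝ} (ht : 0 < t) :
    t ^ Module.finrank ℝ E * ‖surfaceFourier X g ξ‖ ^ 2 =
      ‖∫ u, surfaceAutocorrelation X g ξ (t⁻¹ • u)‖ := by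
  rw [Measure.integral_comp_smul, norm_smul, sq_norm_surfaceFourier hX hg hgc]
  simp [abs_of_pos ht]

/-- Decay of order `dim E + 1` in `u = t h` is integrable and does not depend on `t` or `η`; this is
the dominating function for the limit `t → ∞`. -/
theorem SeparatesGradients.exists_integrable_bound {X : E → F}
    (hX : ContDiff ℝ ∞ X) (hXc : HasCompactSupport X) {Ω : Set F} {D : ℝ} (hΩ : ∀ η ∈ Ω, ‖η‖ ≤ D)
    {W : Set E} {c : ℝ} (hc : 0 < c) (hS : SeparatesGradients X Ω W c) {g : E → ℝ}
    (hg : ContDiff ℝ ∞ g) (hgc : HasCompactSupport g) (hgW : tsupport g ⊆ W) :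
    ∃ β : E → ℝ, Integrable β ∧ ∀ η ∈ Ω, ∀ t : ℝ, 0 < t → ∀ u : E,
      ‖surfaceAutocorrelation X g (t • η) (t⁻¹ • u)‖ ≤ β u := by
  obtain ⟨C, hC0, hC⟩ := hS.exists_one_add_pow_mul_norm_surfaceAutocorrelation_le hX hXc hΩ hc hg
    hgc hgW (Module.finrank ℝ E + 1)
  refine ⟨fun u => C * (1 + ‖u‖) ^ (-((Module.finrank ℝ E + 1 : ℕ) : ℝ)), ?_, fun η hη t ht u => ?_⟩
  · exact (integrable_one_add_norm (by push_cast; linarith)).const_mul C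
  · have h := hC η hη t ht (t⁻¹ • u)
    rw [norm_smul, Real.norm_of_nonneg (inv_nonneg.2 ht.le), mul_inv_cancel_left₀ ht.ne'] at h
    beta_reduce
    rw [Real.rpow_neg (by positivity), Real.rpow_natCast, ← div_eq_mul_inv,
      le_div_iff₀ (by positivity), mul_comm]
    exact h

/-- The decay of the Fourier transform of a curved surface, near a direction of its normals. -/
theorem SeparatesGradients.exists_pow_mul_sq_norm_surfaceFourier_le {X : E → F}
    (hX : ContDiff ℝ ∞ X) (hXc : HasCompactSupport X) {Ω : Set F} {D : ℝ} (hΩ : ∀ η ∈ Ω, ‖η‖ ≤ D)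
    {W : Set E} {c : ℝ} (hc : 0 < c) (hS : SeparatesGradients X Ω W c) {g : E → ℝ}
    (hg : ContDiff ℝ ∞ g) (hgc : HasCompactSupport g) (hgW : tsupport g ⊆ W) :
    ∃ C : ℝ, ∀ η ∈ Ω, ∀ t : ℝ, 0 < t →
      t ^ Module.finrank ℝ E * ‖surfaceFourier X g (t • η)‖ ^ 2 ≤ C := by
  obtain ⟨β, hβ, hA⟩ := hS.exists_integrable_bound hX hXc hΩ hc hg hgc hgW
  refine ⟨∫ u, β u, fun η hη t ht => ?_⟩
  rw [pow_mul_sq_norm_surfaceFourier hX.continuous hg.continuous hgc _ ht]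
  exact norm_integral_le_of_norm_le hβ (Eventually.of_forall (hA η hη t ht))

/-- The Fourier transform, at the pulled-back covector `u ↦ ⟨DX(y) u, η⟩`, of `g²`. -/
noncomputable def gradientFourier (X : E → F) (g : E → ℝ) (η : F) (u : E) : ℂ :=
  ∫ y, (g y * g y) •
    Complex.exp ((-(2 * Real.pi * inner ℝ (fderiv ℝ X y u) η) : ℝ) * Complex.I)

/-- The rescaled increments `t (X(y + u/t) - X(y))` tend to `DX(y) u`. The limit is joint in
direction and size so that it covers a whole cone of frequencies. -/
theorem tendsto_surfaceAutocorrelation {X : E → F} (hX : ContDiff ℝ ∞ X) {g : E → ℝ}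
    (hg : Continuous g) (hgc : HasCompactSupport g) (η₀ : F) (u : E) :
    Tendsto (fun p : F × ℝ => surfaceAutocorrelation X g (p.2 • p.1) (p.2⁻¹ • u))
      (𝓝 η₀ ×ˢ atTop) (𝓝 (gradientFourier X g η₀ u)) := by
  obtain ⟨C, hC⟩ := hgc.exists_bound_of_continuous hg
  have hXc := hX.continuous
  have ht : Tendsto (fun p : F × ℝ => p.2) (𝓝 η₀ ×ˢ atTop) atTop := tendsto_snd
  refine tendsto_integral_filter_of_dominated_convergence (fun y => C * |g y|)
    (Eventually.of_forall fun p => ?_) (Eventually.of_forall fun p => ae_of_all _ fun y => ?_)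
    ((hg.abs.integrable_of_hasCompactSupport hgc.abs).const_mul C) (ae_of_all _ fun y => ?_)
  · exact Continuous.aestronglyMeasurable (by fun_prop)
  · rw [norm_real_smul_exp_ofReal_mul_I, abs_mul]
    gcongr
    exact hC _
  · have h1 : Tendsto (fun p : F × ℝ => y + p.2⁻¹ • u) (𝓝 η₀ ×ˢ atTop) (𝓝 y) := by
      simpa using tendsto_const_nhds.add
        ((tendsto_inv_atTop_zero.comp ht).smul (tendsto_const_nhds (x := u)))
    have h2 : Tendsto (fun p : F × ℝ => p.2 • (X (y + p.2⁻¹ • u) - X y)) (𝓝 η₀ ×ˢ atTop)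
        (𝓝 (fderiv ℝ X y u)) :=
      ((hX.differentiable (by simp)).differentiableAt.hasFDerivAt.lim_real u).comp ht
    have h3 : Tendsto (fun p : F × ℝ => inner ℝ (X (y + p.2⁻¹ • u) - X y) (p.2 • p.1))
        (𝓝 η₀ ×ˢ atTop) (𝓝 (inner ℝ (fderiv ℝ X y u) η₀)) := by
      refine (h2.inner tendsto_fst).congr fun p => ?_
      rw [inner_smul_left, inner_smul_right]; rfl
    refine Tendsto.smul (((hg.tendsto y).comp h1).mul tendsto_const_nhds) ?_
    have : Continuous fun s : ℝ => Complex.exp ((-(2 * Real.pi * s) : ℝ) * Complex.I) := by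
      fun_prop
    exact (this.tendsto _).comp h3

/-- Asymptotics of the Fourier transform of a curved surface near a direction of its normals. -/
theorem SeparatesGradients.tendsto_pow_mul_sq_norm_surfaceFourier {X : E → F}
    (hX : ContDiff ℝ ∞ X) (hXc : HasCompactSupport X) {Ω : Set F} {D : ℝ} (hΩ : ∀ η ∈ Ω, ‖η‖ ≤ D)
    {W : Set E} {c : ℝ} (hc : 0 < c) (hS : SeparatesGradients X Ω W c) {g : E → ℝ}
    (hg : ContDiff ℝ ∞ g) (hgc : HasCompactSupport g) (hgW : tsupport g ⊆ W) {η₀ : F}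
    (hη₀ : Ω ∈ 𝓝 η₀) :
    Integrable (gradientFourier X g η₀) ∧
    Tendsto (fun p : F × ℝ =>
      p.2 ^ Module.finrank ℝ E * ‖surfaceFourier X g (p.2 • p.1)‖ ^ 2) (𝓝 η₀ ×ˢ atTop)
      (𝓝 ‖∫ u, gradientFourier X g η₀ u‖) := by
  obtain ⟨β, hβ, hA⟩ := hS.exists_integrable_bound hX hXc hΩ hc hg hgc hgW
  have hX' := hX.continuous
  have hg' := hg.continuous
  have hX1 : Continuous (fderiv ℝ X) := hX.continuous_fderiv (by simp)
  have hev : ∀ᶠ p : F × ℝ in 𝓝 η₀ ×ˢ atTop, p.1 ∈ Ω ∧ 0 < p.2 :=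
    (tendsto_fst.eventually hη₀).and (tendsto_snd.eventually (eventually_gt_atTop 0))
  have hbd : ∀ᶠ p : F × ℝ in 𝓝 η₀ ×ˢ atTop, ∀ u,
      ‖surfaceAutocorrelation X g (p.2 • p.1) (p.2⁻¹ • u)‖ ≤ β u :=
    hev.mono fun p hp => hA _ hp.1 _ hp.2
  refine ⟨hβ.mono' ?_ (ae_of_all _ fun u => ?_), ?_⟩
  · refine (StronglyMeasurable.integral_prod_right
      (Continuous.stronglyMeasurable ?_)).aestronglyMeasurable
    have h1 : Continuous fun p : E × E => fderiv ℝ X p.2 p.1 :=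
      (hX1.comp continuous_snd).clm_apply continuous_fst
    simp only [Function.uncurry_def]
    fun_prop
  · exact le_of_tendsto (tendsto_surfaceAutocorrelation hX hg' hgc η₀ u).norm
      (hbd.mono fun p hp => hp u)
  · refine Tendsto.congr' (f₁ := fun p : F × ℝ =>
      ‖∫ u, surfaceAutocorrelation X g (p.2 • p.1) (p.2⁻¹ • u)‖) (hev.mono fun p hp =>
        (pow_mul_sq_norm_surfaceFourier hX' hg' hgc _ hp.2).symm) (Tendsto.norm ?_)
    refine tendsto_integral_filter_of_dominated_convergence β (Eventually.of_forall fun p => ?_)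
      (hbd.mono fun p hp => ae_of_all _ hp) hβ
      (ae_of_all _ fun u => tendsto_surfaceAutocorrelation hX hg' hgc η₀ u)
    refine (StronglyMeasurable.integral_prod_right
      (Continuous.stronglyMeasurable ?_)).aestronglyMeasurable
    simp only [Function.uncurry_def]
    fun_prop

/-- The Gaussian weight makes the double integral absolutely convergent; after the exchange, the
inner integral is the Fourier transform of a Gaussian, which is positive. -/
theorem integral_gaussian_mul_gradientFourier {X : E → F} (hX : ContDiff ℝ ∞ X) {g : E → ℝ}
    (hg : Continuous g) (hgc : HasCompactSupport g) (η : F) {s : ℝ} (hs : 0 < s) :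
    ∫ u, Complex.exp (-(s ^ 2 : ℝ) * ‖u‖ ^ 2) * gradientFourier X g η u =
      ((∫ y, (g y * g y) * ((√Real.pi / s) ^ Module.finrank ℝ E *
        Real.exp (-(Real.pi / s * ‖(innerSL ℝ η).comp (fderiv ℝ X y)‖) ^ 2)) : ℝ) : ℂ) := by
  have hX1 : Continuous (fderiv ℝ X) := hX.continuous_fderiv (by simp)
  have hb : (0 : ℝ) < ((s ^ 2 : ℝ) : ℂ).re := by rw [Complex.ofReal_re]; positivity
  have hgi : Integrable fun u : E => Complex.exp (-(s ^ 2 : ℝ) * ‖u‖ ^ 2) := by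
    simpa using GaussianFourier.integrable_cexp_neg_mul_sq_norm_add hb 0 (0 : E)
  have hpow : ((Real.pi : ℂ) / (s ^ 2 : ℝ)) ^ ((Module.finrank ℝ E : ℂ) / 2) =
      (((√Real.pi / s) ^ Module.finrank ℝ E : ℝ) : ℂ) := by
    have h1 : Real.pi / s ^ 2 = (√Real.pi / s) ^ (2 : ℝ) := by
      rw [Real.rpow_two, div_pow, Real.sq_sqrt Real.pi_pos.le]
    have h0 : 0 ≤ √Real.pi / s := by positivity
    rw [show ((Module.finrank ℝ E : ℂ) / 2) = ((Module.finrank ℝ E / 2 : ℝ) : ℂ) by push_cast; rfl,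
      ← Complex.ofReal_div, h1, ← Complex.ofReal_cpow (Real.rpow_nonneg h0 _),
      ← Real.rpow_mul h0, mul_div_cancel₀ _ (two_ne_zero' ℝ), Real.rpow_natCast]
  calc ∫ u, Complex.exp (-(s ^ 2 : ℝ) * ‖u‖ ^ 2) * gradientFourier X g η u
      = ∫ u, ∫ y, Complex.exp (-(s ^ 2 : ℝ) * ‖u‖ ^ 2) * ((g y * g y) •
          Complex.exp ((-(2 * Real.pi * inner ℝ (fderiv ℝ X y u) η) : ℝ) * Complex.I)) := by
        simp_rw [integral_const_mul]; rfl
    _ = ∫ y, ∫ u, Complex.exp (-(s ^ 2 : ℝ) * ‖u‖ ^ 2) * ((g y * g y) •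
          Complex.exp ((-(2 * Real.pi * inner ℝ (fderiv ℝ X y u) η) : ℝ) * Complex.I)) := by
        refine integral_integral_swap ?_
        have hgg : Integrable fun y => ((g y * g y : ℝ) : ℂ) := by
          refine ((hg.mul hg).integrable_of_hasCompactSupport ?_).ofReal
          exact hgc.mul_right
        refine (hgi.mul_prod hgg).mono ?_ (ae_of_all _ fun p => ?_)
        · have h1 : Continuous fun p : E × E => fderiv ℝ X p.2 p.1 :=
            (hX1.comp continuous_snd).clm_apply continuous_fst
          refine Continuous.aestronglyMeasurable ?_
          simp only [Function.uncurry_def]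
          fun_prop
        · simp only [Function.uncurry_def]
          rw [norm_mul, norm_real_smul_exp_ofReal_mul_I, norm_mul, Complex.norm_real,
            Real.norm_eq_abs]
    _ = ∫ y, (((g y * g y) * ((√Real.pi / s) ^ Module.finrank ℝ E *
        Real.exp (-(Real.pi / s * ‖(innerSL ℝ η).comp (fderiv ℝ X y)‖) ^ 2)) : ℝ) : ℂ) := by
        refine integral_congr_ae (ae_of_all _ fun y => ?_)
        set L := (innerSL ℝ η).comp (fderiv ℝ X y)
        set w := (InnerProductSpace.toDual ℝ E).symm L
        have hw : ∀ u, inner ℝ w u = inner ℝ (fderiv ℝ X y u) η := fun u => by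
          rw [InnerProductSpace.toDual_symm_apply, real_inner_comm]; rfl
        have hwn : ‖w‖ = ‖L‖ := LinearIsometryEquiv.norm_map _ _
        have hG := GaussianFourier.integral_cexp_neg_mul_sq_norm_add hb
          (-(2 * Real.pi : ℝ) * Complex.I) w
        rw [hpow, hwn] at hG
        have e : ∀ u : E, Complex.exp (-(s ^ 2 : ℝ) * ‖u‖ ^ 2) * ((g y * g y) •
            Complex.exp ((-(2 * Real.pi * inner ℝ (fderiv ℝ X y u) η) : ℝ) * Complex.I)) =
            ((g y * g y : ℝ) : ℂ) * Complex.exp (-(s ^ 2 : ℝ) * ‖u‖ ^ 2 +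
              -(2 * Real.pi : ℝ) * Complex.I * (inner ℝ w u : ℝ)) := fun u => by
          rw [hw, Complex.exp_add, Complex.real_smul]
          push_cast
          rw [mul_left_comm]
          congr 3
          ring_nf
        simp only
        simp_rw [e]
        rw [integral_const_mul, hG]
        push_cast
        congr 3
        have hs' : (s : ℂ) ≠ 0 := by exact_mod_cast hs.ne'
        have hI : Complex.I ^ 2 = -1 := Complex.I_sq
        field_simp
        rw [hI]
        ring
    _ = _ := integral_ofReal

/-- The regularized integrals have nonnegative integrands. The covector `T y` vanishes at `x₀` and
is `O(‖y - x₀‖)`, so the kernel has size at least a constant times `s⁻ⁿ` on the ball of radius `s`,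
whose volume is of order `sⁿ`. The lower bound survives `s → 0`. -/
theorem integral_gradientFourier_ne_zero {X : E → F} (hX : ContDiff ℝ ∞ X) {g : E → ℝ}
    (hg : Continuous g) (hgc : HasCompactSupport g) {η : F} {x₀ : E} (hx₀ : g x₀ ≠ 0)
    (hη : ∀ v, inner ℝ (fderiv ℝ X x₀ v) η = 0) (hi : Integrable (gradientFourier X g η)) :
    ∫ u, gradientFourier X g η u ≠ 0 := by
  set n := Module.finrank ℝ E
  set T : E → E →L[ℝ] ℝ := fun y => (innerSL ℝ η).comp (fderiv ℝ X y) with hT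
  have hTc : ContDiff ℝ ∞ T := contDiff_const.clm_comp (hX.fderiv_right (m := ∞) (by simp))
  have hT0 : T x₀ = 0 := by
    ext v
    simpa [hT, real_inner_comm] using hη v
  obtain ⟨L, hL⟩ := ((hTc.differentiable (by simp)).differentiableAt
    (x := x₀)).isBigO_sub.bound
  rw [hT0] at hL
  simp only [sub_zero] at hL
  set a := g x₀ * g x₀ / 2 with ha
  have ha0 : 0 < a := by have := mul_self_pos.2 hx₀; positivity
  have hga : ∀ᶠ y in 𝓝 x₀, a < g y * g y :=
    (hg.mul hg).continuousAt.eventually_const_lt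
      (by have := mul_self_pos.2 hx₀; simp only [ha, Pi.mul_apply]; linarith)
  obtain ⟨r, hr, hball⟩ := Metric.eventually_nhds_iff_ball.1 (hL.and hga)
  set κ := a * (√Real.pi ^ n * Real.exp (-(Real.pi * |L|) ^ 2)) *
    (volume : Measure E).real (Metric.ball 0 1)
  have hκ : 0 < κ := by
    have : 0 < (volume : Measure E).real (Metric.ball 0 1) :=
      ENNReal.toReal_pos (Metric.measure_ball_pos _ _ one_pos).ne' measure_ball_lt_top.ne
    positivity
  have hlow : ∀ s : ℝ, 0 < s → s ≤ r →
      κ ≤ (∫ u, Complex.exp (-(s ^ 2 : ℝ) * ‖u‖ ^ 2) * gradientFourier X g η u).re := by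
    intro s hs hsr
    rw [integral_gaussian_mul_gradientFourier hX hg hgc η hs, Complex.ofReal_re]
    set f : E → ℝ := fun y => (g y * g y) * ((√Real.pi / s) ^ n *
        Real.exp (-(Real.pi / s * ‖T y‖) ^ 2))
    have hf0 : ∀ y, 0 ≤ f y := fun y => mul_nonneg (mul_self_nonneg _) (by positivity)
    have hfc : Continuous f := by
      have := hTc.continuous
      fun_prop
    have hfi : Integrable f := hfc.integrable_of_hasCompactSupport (hgc.mul_right.mul_right)
    have hvol : (volume : Measure E).real (Metric.ball x₀ s) =
        s ^ n * (volume : Measure E).real (Metric.ball 0 1) := by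
      rw [Measure.real, Measure.addHaar_ball_of_pos _ _ hs, ENNReal.toReal_mul,
        ENNReal.toReal_ofReal (by positivity)]
      rfl
    calc κ = ∫ y in Metric.ball x₀ s,
          a * ((√Real.pi / s) ^ n * Real.exp (-(Real.pi * |L|) ^ 2)) := by
          rw [setIntegral_const, hvol, smul_eq_mul, div_pow]
          simp only [κ]
          field_simp
      _ ≤ ∫ y in Metric.ball x₀ s, f y := by
          refine setIntegral_mono_on (integrableOn_const measure_ball_lt_top.ne)
            hfi.integrableOn measurableSet_ball fun y hy => ?_
          obtain ⟨h1, h2⟩ := hball y (Metric.ball_subset_ball hsr hy)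
          have h3 : Real.pi / s * ‖T y‖ ≤ Real.pi * |L| := by
            have h4 : ‖y - x₀‖ ≤ s := by rw [← dist_eq_norm]; exact (Metric.mem_ball.1 hy).le
            have h5 : ‖T y‖ ≤ |L| * s := h1.trans (by gcongr; exact le_abs_self L)
            calc Real.pi / s * ‖T y‖ ≤ Real.pi / s * (|L| * s) := by gcongr
              _ = Real.pi * |L| := by field_simp
          refine mul_le_mul h2.le ?_ (by positivity) (mul_self_nonneg _)
          gcongr
      _ ≤ ∫ y, f y := setIntegral_le_integral hfi (ae_of_all _ hf0)
  have hlim : Tendsto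
      (fun s : ℝ => ∫ u, Complex.exp (-(s ^ 2 : ℝ) * ‖u‖ ^ 2) * gradientFourier X g η u)
      (𝓝[>] 0) (𝓝 (∫ u, gradientFourier X g η u)) := by
    refine tendsto_integral_filter_of_dominated_convergence (fun u => ‖gradientFourier X g η u‖)
      (Eventually.of_forall fun s => ?_) (Eventually.of_forall fun s => ae_of_all _ fun u => ?_)
      hi.norm (ae_of_all _ fun u => ?_)
    · exact (Continuous.aestronglyMeasurable (by fun_prop)).mul hi.1
    · rw [norm_mul, Complex.norm_exp]
      refine mul_le_of_le_one_left (norm_nonneg _) (Real.exp_le_one_iff.2 ?_)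
      rw [← Complex.ofReal_pow, ← Complex.ofReal_neg, ← Complex.ofReal_mul, Complex.ofReal_re]
      nlinarith [mul_nonneg (sq_nonneg s) (sq_nonneg ‖u‖)]
    · have : Continuous fun s : ℝ =>
          Complex.exp (-(s ^ 2 : ℝ) * ‖u‖ ^ 2) * gradientFourier X g η u := by fun_prop
      simpa using (this.tendsto 0).mono_left nhdsWithin_le_nhds
  have hre : κ ≤ (∫ u, gradientFourier X g η u).re := by
    refine ge_of_tendsto ((Complex.continuous_re.tendsto _).comp hlim) ?_
    filter_upwards [Ioc_mem_nhdsGT hr] with s hs using hlow s hs.1 hs.2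
  intro h0
  rw [h0, Complex.zero_re] at hre
  linarith

/-- The lower bound for the Fourier transform of a curved surface near a normal direction. -/
theorem SeparatesGradients.exists_eventually_le_pow_mul_sq_norm_surfaceFourier {X : E → F}
    (hX : ContDiff ℝ ∞ X) (hXc : HasCompactSupport X) {Ω : Set F} {D : ℝ} (hΩ : ∀ η ∈ Ω, ‖η‖ ≤ D)
    {W : Set E} {c : ℝ} (hc : 0 < c) (hS : SeparatesGradients X Ω W c) {g : E → ℝ}
    (hg : ContDiff ℝ ∞ g) (hgc : HasCompactSupport g) (hgW : tsupport g ⊆ W) {η₀ : F}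
    (hη₀ : Ω ∈ 𝓝 η₀) {x₀ : E} (hx₀ : g x₀ ≠ 0) (hη : ∀ v, inner ℝ (fderiv ℝ X x₀ v) η₀ = 0) :
    ∃ κ : ℝ, 0 < κ ∧ ∀ᶠ p : F × ℝ in 𝓝 η₀ ×ˢ atTop,
      κ ≤ p.2 ^ Module.finrank ℝ E * ‖surfaceFourier X g (p.2 • p.1)‖ ^ 2 := by
  obtain ⟨hi, hlim⟩ :=
    hS.tendsto_pow_mul_sq_norm_surfaceFourier hX hXc hΩ hc hg hgc hgW hη₀
  have h0 := norm_pos_iff.2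
    (integral_gradientFourier_ne_zero hX hg.continuous hgc hx₀ hη hi)
  exact ⟨_, half_pos h0, (hlim.eventually_const_lt (half_lt_self h0)).mono fun p hp => hp.le⟩

end OscillatoryIntegralAsymptotics

/-! ### Local estimates from a nondegenerate Hessian, and rapid decay off the normals. -/

section LocalEstimates

open Filter Topology

theorem exists_norm_le_one_apply_eq_norm {E : Type*} [NormedAddCommGroup E]
    [InnerProductSpace ℝ E] [CompleteSpace E] (T : E →L[ℝ] ℝ) :
    ∃ v : E, ‖v‖ ≤ 1 ∧ T v = ‖T‖ := by
  set w := (InnerProductSpace.toDual ℝ E).symm T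
  have hw : ∀ u, T u = inner ℝ w u := fun u => (InnerProductSpace.toDual_symm_apply).symm
  have hwn : ‖w‖ = ‖T‖ := LinearIsometryEquiv.norm_map _ _
  refine ⟨‖w‖⁻¹ • w, ?_, ?_⟩
  · rw [norm_smul, norm_inv, norm_norm]; exact inv_mul_le_one
  · rw [hw, inner_smul_right, real_inner_self_eq_norm_sq, ← hwn]
    rcases eq_or_ne ‖w‖ 0 with h | h
    · simp [h]
    · field_simp

variable {E F : Type*} [NormedAddCommGroup E] [InnerProductSpace ℝ E] [FiniteDimensional ℝ E]
  [NormedAddCommGroup F] [InnerProductSpace ℝ F]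

/-- Gradients of phases with a nondegenerate Hessian are separated locally. -/
theorem exists_separatesGradients {X : E → F} (hX : ContDiff ℝ ∞ X) {x₀ : E} {η₀ : F}
    (hH : ∀ h ≠ 0, ∃ v, inner ℝ (fderiv ℝ (fderiv ℝ X) x₀ h v) η₀ ≠ 0) :
    ∃ Ω ∈ 𝓝 η₀, ∃ W ∈ 𝓝 x₀, ∃ c : ℝ, 0 < c ∧ SeparatesGradients X Ω W c := by
  have hX1 : ContDiff ℝ ∞ (fderiv ℝ X) := hX.fderiv_right (by simp)
  have hX2 : Continuous (fderiv ℝ (fderiv ℝ X)) := hX1.continuous_fderiv (by simp)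
  -- The Hessian of the phase `⟨X, η⟩`, as a continuous function of `η` and the base point together.
  set D : F × E → E →L[ℝ] E →L[ℝ] ℝ := fun p =>
    (ContinuousLinearMap.compL ℝ E F ℝ (innerSL ℝ p.1)).comp (fderiv ℝ (fderiv ℝ X) p.2)
  have hD : Continuous D := by
    have h1 : Continuous fun p : F × E => ContinuousLinearMap.compL ℝ E F ℝ (innerSL ℝ p.1) :=
      (ContinuousLinearMap.continuous _).comp ((innerSL ℝ).continuous.comp continuous_fst)
    exact h1.clm_comp (hX2.comp continuous_snd)
  have hDa : ∀ p h v, D p h v = inner ℝ (fderiv ℝ (fderiv ℝ X) p.2 h v) p.1 := fun p h v => by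
    rw [real_inner_comm]; rfl
  set H := D (η₀, x₀)
  have hinj : Function.Injective H := by
    refine (injective_iff_map_eq_zero H).2 fun h h0 => ?_
    by_contra hne
    obtain ⟨v, hv⟩ := hH h hne
    exact hv (by rw [← hDa (η₀, x₀), show D (η₀, x₀) h = 0 from h0]; rfl)
  obtain ⟨K, hK0, hK⟩ := H.toLinearMap.exists_antilipschitzWith
    (LinearMap.ker_eq_bot.2 hinj)
  have hlow : ∀ h, ((K : ℝ))⁻¹ * ‖h‖ ≤ ‖H h‖ := fun h => by
    rw [inv_mul_le_iff₀ (by exact_mod_cast hK0)]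
    simpa using hK.le_mul_dist h 0
  -- `H` expands by at least `2c`; moving the Hessian by at most `c` leaves `c`.
  set c : ℝ := (K : ℝ)⁻¹ / 2 with hc
  have hc0 : 0 < c := by have : (0 : ℝ) < K := by exact_mod_cast hK0
                         positivity
  have hev : ∀ᶠ p in 𝓝 (η₀, x₀), ‖D p - H‖ ≤ c := by
    filter_upwards [hD.continuousAt.eventually (Metric.ball_mem_nhds H hc0)] with p hp
    exact (dist_eq_norm (D p) H ▸ hp).le
  rw [nhds_prod_eq] at hev
  obtain ⟨Ω, hΩ, W, hW, hΩW⟩ := eventually_prod_iff.1 hev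
  obtain ⟨r, hr, hrW⟩ := Metric.eventually_nhds_iff_ball.1 hW
  refine ⟨{η | Ω η}, hΩ, Metric.ball x₀ r, Metric.ball_mem_nhds _ hr, c, hc0, fun η hη h => ?_⟩
  -- The direction is chosen from the frozen Hessian `H`, hence independent of `y`; the mean value
  -- inequality compares the true gradient difference with `H h`.
  obtain ⟨v, hv1, hv⟩ := exists_norm_le_one_apply_eq_norm (-(H h))
  refine ⟨v, hv1, fun y hy hyh => ?_⟩
  have hT : ∀ z, HasFDerivAt (fun z => (innerSL ℝ η).comp (fderiv ℝ X z)) (D (η, z)) z := fun z =>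
    (ContinuousLinearMap.compL ℝ E F ℝ (innerSL ℝ η)).hasFDerivAt.comp z
      (hX1.differentiable (by simp)).differentiableAt.hasFDerivAt
  have hmv := (convex_ball x₀ r).norm_image_sub_le_of_norm_hasFDerivWithin_le'
    (fun z _ => (hT z).hasFDerivWithinAt) (fun z hz => hΩW hη (hrW z hz)) hy hyh
  rw [add_sub_cancel_left] at hmv
  have h1 := (((innerSL ℝ η).comp (fderiv ℝ X (y + h)) -
    (innerSL ℝ η).comp (fderiv ℝ X y) - H h).le_of_opNorm_le_of_le hmv hv1)
  rw [mul_one, Real.norm_eq_abs] at h1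
  have h2 := (abs_le.1 h1).2
  simp only [sub_apply, ContinuousLinearMap.comp_apply, innerSL_apply_apply] at h2
  rw [norm_neg] at hv
  have h3 : (-(H h)) v = -(H h v) := rfl
  have h4 := hlow h
  have h5 : (K : ℝ)⁻¹ * ‖h‖ = 2 * (c * ‖h‖) := by rw [hc]; ring
  rw [inner_sub_left]
  rw [real_inner_comm, real_inner_comm (fderiv ℝ X y v)] at h2
  linarith

variable [MeasurableSpace E] [BorelSpace E]

/-- Rapid decay of the Fourier transform of a surface away from the directions of its normals. -/
theorem exists_pow_mul_norm_surfaceFourier_le_of_not_normal {X : E → F} (hX : ContDiff ℝ ∞ X)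
    (hXc : HasCompactSupport X) {x₀ : E} {η₀ : F} {v : E}
    (hv : inner ℝ (fderiv ℝ X x₀ v) η₀ ≠ 0) :
    ∃ Ω ∈ 𝓝 η₀, ∃ W ∈ 𝓝 x₀, ∀ g : E → ℝ, ContDiff ℝ ∞ g → HasCompactSupport g →
      tsupport g ⊆ W → ∀ N : ℕ, ∃ C : ℝ, 0 ≤ C ∧ ∀ η ∈ Ω, ∀ t : ℝ, 0 < t →
        t ^ N * ‖surfaceFourier X g (t • η)‖ ≤ C := by
  have hX1 : Continuous (fderiv ℝ X) := hX.continuous_fderiv (by simp)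
  obtain ⟨w, hw1, hw⟩ : ∃ w : E, ‖w‖ ≤ 1 ∧ 0 < -inner ℝ (fderiv ℝ X x₀ w) η₀ := by
    obtain ⟨w, hw1, hw⟩ :=
      exists_norm_le_one_apply_eq_norm (-((innerSL ℝ η₀).comp (fderiv ℝ X x₀)))
    refine ⟨w, hw1, ?_⟩
    have h1 : (-((innerSL ℝ η₀).comp (fderiv ℝ X x₀))) w = -inner ℝ (fderiv ℝ X x₀ w) η₀ := by
      rw [real_inner_comm]; rfl
    rw [← h1, hw, norm_pos_iff]
    intro h0
    refine hv ?_
    have := congrArg (fun T : E →L[ℝ] ℝ => T v) h0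
    rw [real_inner_comm]
    simpa using this
  set c := -inner ℝ (fderiv ℝ X x₀ w) η₀ / 2 with hc
  have hc0 : 0 < c := half_pos hw
  have hcont : Continuous fun p : F × E => -inner ℝ (fderiv ℝ X p.2 w) p.1 :=
    (((hX1.comp continuous_snd).clm_apply continuous_const).inner continuous_fst).neg
  have hev : ∀ᶠ p : F × E in 𝓝 (η₀, x₀), c < -inner ℝ (fderiv ℝ X p.2 w) p.1 :=
    hcont.continuousAt.eventually_const_lt (half_lt_self hw)
  rw [nhds_prod_eq] at hev
  obtain ⟨Ω, hΩ, W, hW, hΩW⟩ := eventually_prod_iff.1 hev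
  refine ⟨{η | Ω η} ∩ Metric.ball η₀ 1, inter_mem hΩ (Metric.ball_mem_nhds _ one_pos), {y | W y},
    hW, fun g hg hgc hgW N => ?_⟩
  let ι := {η : F // η ∈ {η | Ω η} ∩ Metric.ball η₀ 1}
  have hdψ : ∀ (η : F) y u, fderiv ℝ (fun y => -inner ℝ (X y) η) y u =
      -inner ℝ (fderiv ℝ X y u) η := fun η y u => by
    have h1 := (((hX.differentiable (by simp)).differentiableAt (x := y)).hasFDerivAt.inner ℝ
      (hasFDerivAt_const η y)).neg
    have h2 : fderiv ℝ (fun y => -inner ℝ (X y) η) y = _ := h1.fderiv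
    rw [h2]
    simp
  have hXU : UniformlySmooth fun _ : ι => X := .of_hasCompactSupport hX hXc
  obtain ⟨C, hC0, hC⟩ := UniformlySmooth.exists_pow_mul_norm_integral_le (ι := ι) volume
    (ψ := fun η y => -inner ℝ (X y) η.1) (v := fun _ => w) (b := fun _ => g)
    (fun η => (hX.inner ℝ contDiff_const).neg) (fun _ => hw1)
    (by
      have h1 := (hXU.fderiv_apply fun _ => hw1).clm_comp
        (L := fun η : ι => -innerSL ℝ η.1) (D := ‖η₀‖ + 1) fun η => by
          rw [norm_neg, innerSL_apply_norm]
          have := norm_le_norm_add_norm_sub η₀ η.1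
          have h2 := mem_ball_iff_norm'.1 η.2.2
          linarith
      convert h1 using 3 with η y
      rw [hdψ]
      simp [real_inner_comm])
    hc0 hgc.isCompact N (.of_hasCompactSupport hg hgc) (fun _ => subset_rfl)
    (fun η y hy => by rw [hdψ]; exact (hΩW η.2.1 (hgW hy)).le)
  refine ⟨C, hC0, fun η hη t ht => ?_⟩
  refine le_trans ?_ (hC ⟨η, hη⟩ (2 * Real.pi * t) (by positivity))
  refine mul_le_mul (pow_le_pow_left₀ ht.le ?_ N) (le_of_eq ?_) (norm_nonneg _) (by positivity)
  · have : 1 ≤ 2 * Real.pi := by linarith [Real.two_le_pi]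
    nlinarith
  · rw [surfaceFourier]
    congr 2
    ext y
    congr 4
    rw [inner_smul_right]
    ring

theorem norm_surfaceFourier_le {X : E → F} {g : E → ℝ} (ξ : F) :
    ‖surfaceFourier X g ξ‖ ≤ ∫ x, |g x| := by
  refine (norm_integral_le_integral_norm _).trans (le_of_eq ?_)
  simp_rw [norm_real_smul_exp_ofReal_mul_I]

/-- The decay of the Fourier transform of a surface all of whose phases have a nondegenerate Hessian
at their critical point `x₀`. -/
theorem exists_one_add_norm_pow_mul_sq_norm_surfaceFourier_le [FiniteDimensional ℝ F]
    {X : E → F} (hX : ContDiff ℝ ∞ X) (hXc : HasCompactSupport X) {x₀ : E}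
    (hH : ∀ η : F, ‖η‖ = 1 → (∀ v, inner ℝ (fderiv ℝ X x₀ v) η = 0) →
      ∀ h ≠ 0, ∃ v, inner ℝ (fderiv ℝ (fderiv ℝ X) x₀ h v) η ≠ 0) :
    ∃ W ∈ 𝓝 x₀, ∀ g : E → ℝ, ContDiff ℝ ∞ g → HasCompactSupport g → tsupport g ⊆ W →
      ∃ C : ℝ, ∀ ξ : F,
        (1 + ‖ξ‖) ^ Module.finrank ℝ E * ‖surfaceFourier X g ξ‖ ^ 2 ≤ C := by
  set n := Module.finrank ℝ E
  have hsphere : ∃ W ∈ 𝓝 x₀, ∀ g : E → ℝ, ContDiff ℝ ∞ g → HasCompactSupport g →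
      tsupport g ⊆ W → ∃ C : ℝ, ∀ η ∈ Metric.sphere (0 : F) 1, ∀ t : ℝ, 1 ≤ t →
        t ^ n * ‖surfaceFourier X g (t • η)‖ ^ 2 ≤ C := by
    refine (isCompact_sphere (0 : F) 1).induction_on (p := fun s =>
      ∃ W ∈ 𝓝 x₀, ∀ g : E → ℝ, ContDiff ℝ ∞ g → HasCompactSupport g →
        tsupport g ⊆ W → ∃ C : ℝ, ∀ η ∈ s, ∀ t : ℝ, 1 ≤ t →
          t ^ n * ‖surfaceFourier X g (t • η)‖ ^ 2 ≤ C) ?_ ?_ ?_ ?_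
    · exact ⟨Set.univ, univ_mem, fun g _ _ _ => ⟨0, by simp⟩⟩
    · rintro s s' hss ⟨W, hW, h⟩
      exact ⟨W, hW, fun g hg hgc hgW => (h g hg hgc hgW).imp fun C hC η hη => hC η (hss hη)⟩
    · rintro s s' ⟨W, hW, h⟩ ⟨W', hW', h'⟩
      refine ⟨W ∩ W', inter_mem hW hW', fun g hg hgc hgW => ?_⟩
      obtain ⟨C, hC⟩ := h g hg hgc (hgW.trans Set.inter_subset_left)
      obtain ⟨C', hC'⟩ := h' g hg hgc (hgW.trans Set.inter_subset_right)
      refine ⟨max C C', fun η hη t ht => ?_⟩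
      rcases hη with hη | hη
      exacts [(hC η hη t ht).trans (le_max_left _ _), (hC' η hη t ht).trans (le_max_right _ _)]
    · intro η₀ hη₀
      by_cases hn : ∀ v, inner ℝ (fderiv ℝ X x₀ v) η₀ = 0
      · obtain ⟨Ω, hΩ, W, hW, c, hc, hS⟩ :=
          exists_separatesGradients hX (hH η₀ (by simpa using hη₀) hn)
        refine ⟨Ω ∩ Metric.sphere 0 1, inter_mem (mem_nhdsWithin_of_mem_nhds hΩ)
          self_mem_nhdsWithin, W, hW, fun g hg hgc hgW => ?_⟩
        have hS' : SeparatesGradients X (Ω ∩ Metric.sphere 0 1) W c := fun η hη => hS η hη.1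
        obtain ⟨C, hC⟩ := hS'.exists_pow_mul_sq_norm_surfaceFourier_le hX hXc (D := 1)
          (fun η hη => by simpa using hη.2.le) hc hg hgc hgW
        exact ⟨C, fun η hη t ht => hC η hη t (one_pos.trans_le ht)⟩
      · push Not at hn
        obtain ⟨v, hv⟩ := hn
        obtain ⟨Ω, hΩ, W, hW, h⟩ :=
          exists_pow_mul_norm_surfaceFourier_le_of_not_normal hX hXc hv
        refine ⟨Ω, mem_nhdsWithin_of_mem_nhds hΩ, W, hW, fun g hg hgc hgW => ?_⟩
        -- Squaring the bound gives decay `t⁻²ⁿ` of the square, more than enough for `t ≥ 1`.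
        obtain ⟨C, hC0, hC⟩ := h g hg hgc hgW n
        refine ⟨C ^ 2, fun η hη t ht => ?_⟩
        have h1 := pow_le_pow_left₀ (by positivity) (hC η hη t (one_pos.trans_le ht)) 2
        refine le_trans ?_ h1
        rw [mul_pow]
        gcongr
        exact le_self_pow₀ (one_le_pow₀ ht) two_ne_zero
  obtain ⟨W, hW, h⟩ := hsphere
  refine ⟨W, hW, fun g hg hgc hgW => ?_⟩
  obtain ⟨C, hC⟩ := h g hg hgc hgW
  refine ⟨2 ^ n * max C ((∫ x, |g x|) ^ 2), fun ξ => ?_⟩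
  rcases le_total ‖ξ‖ 1 with hξ | hξ
  · have h2 : (1 + ‖ξ‖) ^ n ≤ 2 ^ n := pow_le_pow_left₀ (by positivity) (by linarith) n
    refine mul_le_mul h2 (le_max_of_le_right ?_) (by positivity) (by positivity)
    exact pow_le_pow_left₀ (norm_nonneg _) (norm_surfaceFourier_le ξ) 2
  · have h0 : ‖ξ‖ ≠ 0 := (one_pos.trans_le hξ).ne'
    have h1 := hC (‖ξ‖⁻¹ • ξ) (by simp [norm_smul, h0]) ‖ξ‖ hξ
    rw [smul_inv_smul₀ h0] at h1
    have h2 : (1 + ‖ξ‖) ^ n ≤ 2 ^ n * ‖ξ‖ ^ n := by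
      rw [← mul_pow]; exact pow_le_pow_left₀ (by positivity) (by linarith) n
    calc _ ≤ 2 ^ n * ‖ξ‖ ^ n * ‖surfaceFourier X g ξ‖ ^ 2 := by gcongr
      _ ≤ _ := by rw [mul_assoc]; gcongr; exact h1.trans (le_max_left _ _)

end LocalEstimates

/-! ### Curved patches: both Fourier estimates for a localized amplitude. -/

section Patches

open Filter Topology

/-- A smooth nonnegative amplitude, compactly supported in `U`, that does not vanish at `x₀`. -/
structure IsAmplitude {E : Type*} [NormedAddCommGroup E] [NormedSpace ℝ E] (U : Set E) (x₀ : E)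
    (g : E → ℝ) : Prop where
  contDiff : ContDiff ℝ ∞ g
  hasCompactSupport : HasCompactSupport g
  tsupport_subset : tsupport g ⊆ U
  nonneg : ∀ x, 0 ≤ g x
  ne_zero : g x₀ ≠ 0

theorem exists_isAmplitude {E : Type*} [NormedAddCommGroup E] [NormedSpace ℝ E]
    [FiniteDimensional ℝ E] {U : Set E} {x₀ : E} (hU : U ∈ 𝓝 x₀) :
    ∃ g : E → ℝ, IsAmplitude U x₀ g := by
  obtain ⟨g, h1, h2, h3, h4, h5⟩ := exists_contDiff_tsupport_subset (n := ⊤) hU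
  exact ⟨g, h3, h2, h1, fun x => (h4 ⟨x, rfl⟩).1, by simp [h5]⟩

theorem IsAmplitude.mono {E : Type*} [NormedAddCommGroup E] [NormedSpace ℝ E] {U U' : Set E}
    {x₀ : E} {g : E → ℝ} (hg : IsAmplitude U x₀ g) (h : U ⊆ U') : IsAmplitude U' x₀ g :=
  ⟨hg.contDiff, hg.hasCompactSupport, hg.tsupport_subset.trans h, hg.nonneg, hg.ne_zero⟩

theorem surfaceFourier_congr {E F : Type*} [NormedAddCommGroup E] [InnerProductSpace ℝ E]
    [FiniteDimensional ℝ E] [MeasurableSpace E] [BorelSpace E] [NormedAddCommGroup F]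
    [InnerProductSpace ℝ F] {X Y : E → F} {g : E → ℝ}
    (h : Set.EqOn X Y (tsupport g)) : surfaceFourier X g = surfaceFourier Y g := by
  ext ξ
  refine integral_congr_ae (ae_of_all _ fun x => ?_)
  by_cases hx : x ∈ tsupport g
  · simp only [h hx]
  · simp [image_eq_zero_of_notMem_tsupport hx]

theorem continuous_surfaceFourier {E F : Type*} [NormedAddCommGroup E] [InnerProductSpace ℝ E]
    [FiniteDimensional ℝ E] [MeasurableSpace E] [BorelSpace E] [NormedAddCommGroup F]
    [InnerProductSpace ℝ F] {X : E → F} {g : E → ℝ} (hX : Continuous X) (hg : Continuous g)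
    (hgc : HasCompactSupport g) : Continuous (surfaceFourier X g) := by
  refine continuous_of_dominated (bound := fun x => |g x|)
    (fun ξ => Continuous.aestronglyMeasurable (by fun_prop))
    (fun ξ => ae_of_all _ fun x => (norm_real_smul_exp_ofReal_mul_I _ _).le)
    (hg.abs.integrable_of_hasCompactSupport hgc.abs) (ae_of_all _ fun x => by fun_prop)

variable {k d : ℕ} {U : Set (EuclideanSpace ℝ (Fin k))}
  {χ : EuclideanSpace ℝ (Fin k) → EuclideanSpace ℝ (Fin d)}

theorem mem_patchNormal_iff {x : EuclideanSpace ℝ (Fin k)} {η : EuclideanSpace ℝ (Fin d)} :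
    η ∈ patchNormal χ x ↔ ∀ v, inner ℝ (fderiv ℝ χ x v) η = 0 := by
  rw [patchNormal, Submodule.mem_orthogonal]
  simp [patchTangent]

/-- If every pairing vanished, `h` would be a nonzero left null vector of the second fundamental
form, and the curvature would be zero. -/
theorem HasNonvanishingCurvature.exists_inner_ne_zero (hK : HasNonvanishingCurvature U χ)
    {x : EuclideanSpace ℝ (Fin k)} (hx : x ∈ U) {η : EuclideanSpace ℝ (Fin d)} (hη1 : ‖η‖ = 1)
    (hη : η ∈ patchNormal χ x) (h : EuclideanSpace ℝ (Fin k)) (hh : h ≠ 0) :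
    ∃ v, inner ℝ (fderiv ℝ (fderiv ℝ χ) x h v) η ≠ 0 := by
  by_contra! hall
  have hdet : (secondForm χ x η).det ≠ 0 := fun h0 => hK x hx η hη hη1 (by
    rw [gaussianCurvature, h0, zero_div])
  refine hh ?_
  have hz : Matrix.vecMul h.ofLp (secondForm χ x η) = 0 := by
    ext j
    have h1 : h = ∑ i, h.ofLp i • EuclideanSpace.single i (1 : ℝ) := by
      ext j
      simp [Pi.single_apply]
    have h2 := hall (EuclideanSpace.single j 1)
    rw [h1] at h2
    simp only [map_sum, map_smul, sum_apply, smul_apply,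
      sum_inner, inner_smul_left] at h2
    simpa [Matrix.vecMul, dotProduct, secondForm] using h2
  have := Matrix.eq_zero_of_vecMul_eq_zero hdet hz
  ext j
  exact congrFun this j

/-- A patch agrees near each of its points with a smooth map of compact support. -/
theorem IsSmoothPatch.exists_contDiff_hasCompactSupport (hχ : IsSmoothPatch U χ)
    {x₀ : EuclideanSpace ℝ (Fin k)} (hx₀ : x₀ ∈ U) :
    ∃ X : EuclideanSpace ℝ (Fin k) → EuclideanSpace ℝ (Fin d),
      ContDiff ℝ ∞ X ∧ HasCompactSupport X ∧ X =ᶠ[𝓝 x₀] χ := by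
  obtain ⟨r, hr, hrU⟩ := Metric.nhds_basis_closedBall.mem_iff.1 (hχ.isOpen.mem_nhds hx₀)
  let κ : ContDiffBump x₀ := ⟨r / 2, r, half_pos hr, half_lt_self hr⟩
  have hsub : tsupport (fun x => κ x • χ x) ⊆ U := by
    refine (tsupport_smul_subset_left _ _).trans ?_
    rw [show tsupport (fun x => κ x) = _ from κ.tsupport_eq]
    exact hrU
  refine ⟨fun x => κ x • χ x, ?_, κ.hasCompactSupport.smul_right, ?_⟩
  · refine contDiff_iff_contDiffAt.2 fun x => ?_
    by_cases hx : x ∈ tsupport fun x => κ x • χ x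
    · exact κ.contDiff.contDiffAt.smul
        (hχ.contDiffOn.contDiffAt (hχ.isOpen.mem_nhds (hsub hx)))
    · exact contDiffAt_const.congr_of_eventuallyEq (notMem_tsupport_iff_eventuallyEq.1 hx)
  · filter_upwards [κ.eventuallyEq_one] with x hx
    simp [hx]

theorem fderiv_fderiv_congr {E F : Type*} [NormedAddCommGroup E] [NormedSpace ℝ E]
    [NormedAddCommGroup F] [NormedSpace ℝ F] {X Y : E → F} {x : E} (h : X =ᶠ[𝓝 x] Y) :
    fderiv ℝ (fderiv ℝ X) x = fderiv ℝ (fderiv ℝ Y) x :=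
  h.fderiv.fderiv_eq

/-- The Fourier transform of a curved hypersurface, localized near a point, decays. -/
theorem IsSmoothPatch.exists_isAmplitude_decay (hχ : IsSmoothPatch U χ)
    (hK : HasNonvanishingCurvature U χ) {x₀ : EuclideanSpace ℝ (Fin k)} (hx₀ : x₀ ∈ U) :
    ∃ g, IsAmplitude U x₀ g ∧ Continuous (surfaceFourier χ g) ∧
      ∃ C : ℝ, ∀ ξ, (1 + ‖ξ‖) ^ k * ‖surfaceFourier χ g ξ‖ ^ 2 ≤ C := by
  obtain ⟨X, hX, hXc, hXχ⟩ := hχ.exists_contDiff_hasCompactSupport hx₀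
  obtain ⟨W, hW, h⟩ := exists_one_add_norm_pow_mul_sq_norm_surfaceFourier_le hX hXc (x₀ := x₀)
    fun η hη1 hη => by
      rw [fderiv_fderiv_congr hXχ]
      rw [hXχ.fderiv_eq] at hη
      exact hK.exists_inner_ne_zero hx₀ hη1 (mem_patchNormal_iff.2 hη)
  obtain ⟨g, hg⟩ := exists_isAmplitude
    (inter_mem (inter_mem hW hXχ) (hχ.isOpen.mem_nhds hx₀))
  refine ⟨g, hg.mono Set.inter_subset_right, ?_⟩
  have hsub := hg.tsupport_subset.trans Set.inter_subset_left
  obtain ⟨C, hC⟩ := h g hg.contDiff hg.hasCompactSupport (hsub.trans Set.inter_subset_left)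
  have hcont := continuous_surfaceFourier hX.continuous hg.contDiff.continuous hg.hasCompactSupport
  have hcongr : surfaceFourier X g = surfaceFourier χ g :=
    surfaceFourier_congr fun x hx => (hsub.trans Set.inter_subset_right) hx
  rw [finrank_euclideanSpace_fin, hcongr] at hC
  exact ⟨hcongr ▸ hcont, C, hC⟩

/-- The Fourier transform of a curved hypersurface, localized near a point, does not decay any
faster near the directions of its normal line there. -/
theorem IsSmoothPatch.exists_isAmplitude_le (hχ : IsSmoothPatch U χ)
    (hK : HasNonvanishingCurvature U χ) {x₀ : EuclideanSpace ℝ (Fin k)} (hx₀ : x₀ ∈ U)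
    {η₀ : EuclideanSpace ℝ (Fin d)} (hη1 : ‖η₀‖ = 1) (hη : η₀ ∈ patchNormal χ x₀) :
    ∃ g, IsAmplitude U x₀ g ∧ ∃ κ : ℝ, 0 < κ ∧
      ∀ᶠ p : EuclideanSpace ℝ (Fin d) × ℝ in 𝓝 η₀ ×ˢ atTop,
        κ ≤ p.2 ^ k * ‖surfaceFourier χ g (p.2 • p.1)‖ ^ 2 := by
  obtain ⟨X, hX, hXc, hXχ⟩ := hχ.exists_contDiff_hasCompactSupport hx₀
  obtain ⟨Ω, hΩ, W, hW, c, hc, hS⟩ := exists_separatesGradients hX (x₀ := x₀) (η₀ := η₀) (by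
    rw [fderiv_fderiv_congr hXχ]
    exact hK.exists_inner_ne_zero hx₀ hη1 hη)
  obtain ⟨g, hg⟩ := exists_isAmplitude
    (inter_mem (inter_mem hW hXχ) (hχ.isOpen.mem_nhds hx₀))
  refine ⟨g, hg.mono Set.inter_subset_right, ?_⟩
  have hsub := hg.tsupport_subset.trans Set.inter_subset_left
  -- The estimates need a bounded set of directions; this ball is still a neighbourhood of the unit
  -- vector `η₀`.
  have hS' : SeparatesGradients X (Ω ∩ Metric.closedBall 0 2) W c := fun η hη => hS η hη.1
  obtain ⟨κ, hκ, hκ'⟩ := hS'.exists_eventually_le_pow_mul_sq_norm_surfaceFourier hX hXc (D := 2)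
    (fun η hη => by simpa using hη.2) hc hg.contDiff hg.hasCompactSupport
    (hsub.trans Set.inter_subset_left) (η₀ := η₀)
    (inter_mem hΩ (mem_of_superset (Metric.ball_mem_nhds η₀ one_pos) fun η hη => by
      have h1 := norm_le_norm_add_norm_sub η₀ η
      have h2 := mem_ball_iff_norm'.1 hη
      simp only [Metric.mem_closedBall, dist_zero_right]
      linarith)) hg.ne_zero (by rw [hXχ.fderiv_eq]; exact mem_patchNormal_iff.1 hη)
  refine ⟨κ, hκ, ?_⟩
  rwa [finrank_euclideanSpace_fin,
    surfaceFourier_congr fun x hx => (hsub.trans Set.inter_subset_right) hx] at hκ'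

end Patches

/-! ### Frame inequalities for smooth densities on one patch. -/

section Densities

open Filter Topology

variable {k d M : ℕ}

theorem IsSmoothPatch.det_firstForm_pos {U : Set (EuclideanSpace ℝ (Fin k))}
    {χ : EuclideanSpace ℝ (Fin k) → EuclideanSpace ℝ (Fin d)} (hχ : IsSmoothPatch U χ)
    {x : EuclideanSpace ℝ (Fin k)} (hx : x ∈ U) : 0 < (firstForm χ x).det := by
  have hli : LinearIndependent ℝ fun i : Fin k => fderiv ℝ χ x (EuclideanSpace.single i 1) := by
    have h1 := (EuclideanSpace.basisFun (Fin k) ℝ).toBasis.linearIndependent.map'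
      (fderiv ℝ χ x).toLinearMap (LinearMap.ker_eq_bot.2 (hχ.injective_fderiv x hx))
    have h2 : (fun i : Fin k => fderiv ℝ χ x (EuclideanSpace.single i 1)) =
        (fderiv ℝ χ x).toLinearMap ∘ (EuclideanSpace.basisFun (Fin k) ℝ).toBasis := by
      ext i
      simp
    rwa [h2]
  exact (Matrix.posDef_gram_of_linearIndependent (𝕜 := ℝ) hli).det_pos

theorem IsSmoothPatch.continuousOn_det_firstForm {U : Set (EuclideanSpace ℝ (Fin k))}
    {χ : EuclideanSpace ℝ (Fin k) → EuclideanSpace ℝ (Fin d)} (hχ : IsSmoothPatch U χ) :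
    ContinuousOn (fun x => (firstForm χ x).det) U := by
  have h1 : ContinuousOn (fderiv ℝ χ) U := hχ.contDiffOn.continuousOn_fderiv_of_isOpen hχ.isOpen
    (by simp)
  have h2 : ContinuousOn (firstForm χ) U := by
    refine continuousOn_pi.2 fun i => continuousOn_pi.2 fun j => ?_
    exact (h1.clm_apply continuousOn_const).inner (h1.clm_apply continuousOn_const)
  exact (Continuous.matrix_det continuous_id).comp_continuousOn h2

/-- The push-forward of the density `g` under the patch `χ`. -/
noncomputable def amplitudeMeasure (U : Set (EuclideanSpace ℝ (Fin k)))
    (χ : EuclideanSpace ℝ (Fin k) → EuclideanSpace ℝ (Fin d))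
    (g : EuclideanSpace ℝ (Fin k) → ℝ) : Measure (EuclideanSpace ℝ (Fin d)) :=
  ((volume.restrict U).withDensity fun x => ENNReal.ofReal (g x)).map χ

theorem IsSmoothPatch.aemeasurable {U : Set (EuclideanSpace ℝ (Fin k))}
    {χ : EuclideanSpace ℝ (Fin k) → EuclideanSpace ℝ (Fin d)} (hχ : IsSmoothPatch U χ) :
    AEMeasurable χ (volume.restrict U) :=
  hχ.contDiffOn.continuousOn.aemeasurable hχ.isOpen.measurableSet

/-- The area density is continuous and positive on the compact support of `g`, so `g` divided by it
is bounded there. -/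
theorem IsSmoothPatch.exists_amplitudeMeasure_le {U : Set (EuclideanSpace ℝ (Fin k))}
    {χ : EuclideanSpace ℝ (Fin k) → EuclideanSpace ℝ (Fin d)} (hχ : IsSmoothPatch U χ)
    {x₀ : EuclideanSpace ℝ (Fin k)} {g : EuclideanSpace ℝ (Fin k) → ℝ} (hg : IsAmplitude U x₀ g) :
    ∃ K : ℝ≥0, amplitudeMeasure U χ g ≤ K • patchMeasure U χ := by
  have hcont : ContinuousOn (fun x => g x / √(firstForm χ x).det) (tsupport g) :=
    hg.contDiff.continuous.continuousOn.div
      (hχ.continuousOn_det_firstForm.mono hg.tsupport_subset).sqrt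
      fun x hx => (Real.sqrt_pos.2 (hχ.det_firstForm_pos (hg.tsupport_subset hx))).ne'
  obtain ⟨K, hK⟩ := hg.hasCompactSupport.isCompact.exists_bound_of_continuousOn hcont
  have hle : ∀ x, ENNReal.ofReal (g x) ≤
      (K.toNNReal : ℝ≥0∞) * ENNReal.ofReal √(firstForm χ x).det := fun x => by
    by_cases hx : x ∈ tsupport g
    · have hpos := Real.sqrt_pos.2 (hχ.det_firstForm_pos (hg.tsupport_subset hx))
      have h1 := (le_abs_self _).trans (hK x hx)
      rw [div_le_iff₀ hpos] at h1
      change _ ≤ ENNReal.ofReal K * _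
      rw [← ENNReal.ofReal_mul' hpos.le]
      exact ENNReal.ofReal_le_ofReal h1
    · simp [image_eq_zero_of_notMem_tsupport hx]
  refine ⟨K.toNNReal, ?_⟩
  have h1 : (volume.restrict U).withDensity (fun x => ENNReal.ofReal (g x)) ≤
      K.toNNReal • (volume.restrict U).withDensity
        fun x => ENNReal.ofReal √(firstForm χ x).det := by
    refine (withDensity_mono (ae_of_all _ hle)).trans (le_of_eq ?_)
    exact withDensity_smul' _ _ ENNReal.coe_ne_top
  have hae : AEMeasurable χ (K.toNNReal • (volume.restrict U).withDensity
        fun x => ENNReal.ofReal √(firstForm χ x).det) :=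
    (hχ.aemeasurable.mono_ac (withDensity_absolutelyContinuous _ _)).smul_measure _
  refine (Measure.map_mono_of_aemeasurable h1 hae).trans (le_of_eq ?_)
  rw [patchMeasure, Measure.map_smul]

/-- The multiplicity is at most `M`, so the normalization loses at most a factor `M`. -/
theorem patchMeasure_le_smul_surfaceMeasure (U : Fin M → Set (EuclideanSpace ℝ (Fin k)))
    (χ : Fin M → EuclideanSpace ℝ (Fin k) → EuclideanSpace ℝ (Fin d)) (i : Fin M) :
    patchMeasure (U i) (χ i) ≤ (M : ℝ≥0) • surfaceMeasure U χ := by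
  have hM : (M : ℝ≥0∞) ≠ 0 := by exact_mod_cast (Fin.pos i).ne'
  refine Measure.le_iff.2 fun s _ => ?_
  have h1 : (M : ℝ≥0∞)⁻¹ * patchMeasure (U i) (χ i) s ≤ surfaceMeasure U χ s := by
    calc (M : ℝ≥0∞)⁻¹ * patchMeasure (U i) (χ i) s
        = (patchMeasure (U i) (χ i)).withDensity (fun _ => (M : ℝ≥0∞)⁻¹) s := by
          rw [withDensity_const, Measure.smul_apply, smul_eq_mul]
      _ ≤ (patchMeasure (U i) (χ i)).withDensity
          (fun p => (patchMultiplicity U χ p : ℝ≥0∞)⁻¹) s := by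
          refine withDensity_mono (ae_of_all _ fun p => ENNReal.inv_le_inv.2 ?_) s
          exact_mod_cast (Set.ncard_le_card _).trans (by simp)
      _ ≤ surfaceMeasure U χ s := by
          rw [surfaceMeasure, Measure.finsetSum_apply]
          exact Finset.single_le_sum (f := fun i => (patchMeasure (U i) (χ i)).withDensity
            (fun p => (patchMultiplicity U χ p : ℝ≥0∞)⁻¹) s) (fun _ _ => zero_le)
            (Finset.mem_univ i)
  rw [Measure.smul_apply, ENNReal.smul_def, smul_eq_mul, ENNReal.coe_natCast]
  calc patchMeasure (U i) (χ i) s = M * ((M : ℝ≥0∞)⁻¹ * patchMeasure (U i) (χ i) s) := by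
        rw [← mul_assoc, ENNReal.mul_inv_cancel hM (ENNReal.natCast_ne_top M), one_mul]
    _ ≤ _ := by gcongr

theorem IsSmoothPatch.integral_amplitudeMeasure {U : Set (EuclideanSpace ℝ (Fin k))}
    {χ : EuclideanSpace ℝ (Fin k) → EuclideanSpace ℝ (Fin d)} (hχ : IsSmoothPatch U χ)
    {x₀ : EuclideanSpace ℝ (Fin k)} {g : EuclideanSpace ℝ (Fin k) → ℝ} (hg : IsAmplitude U x₀ g)
    (ξ : EuclideanSpace ℝ (Fin d)) :
    ∫ p, Complex.exp ((-(2 * Real.pi * inner ℝ p ξ) : ℝ) * Complex.I) ∂amplitudeMeasure U χ g =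
      surfaceFourier χ g ξ := by
  rw [amplitudeMeasure, integral_map
    (hχ.aemeasurable.mono_ac (withDensity_absolutelyContinuous _ _))
    (Continuous.aestronglyMeasurable (by fun_prop)),
    integral_withDensity_eq_integral_toReal_smul
      (hg.contDiff.continuous.measurable.ennreal_ofReal)
      (ae_of_all _ fun _ => ENNReal.ofReal_lt_top), surfaceFourier]
  simp_rw [ENNReal.toReal_ofReal (hg.nonneg _)]
  refine setIntegral_eq_integral_of_forall_compl_eq_zero fun x hx => ?_
  rw [image_eq_zero_of_notMem_tsupport fun h => hx (hg.tsupport_subset h), zero_smul]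

theorem IsAmplitude.surfaceFourier_zero_ne_zero {U : Set (EuclideanSpace ℝ (Fin k))}
    {χ : EuclideanSpace ℝ (Fin k) → EuclideanSpace ℝ (Fin d)}
    {x₀ : EuclideanSpace ℝ (Fin k)} {g : EuclideanSpace ℝ (Fin k) → ℝ} (hg : IsAmplitude U x₀ g) :
    surfaceFourier χ g 0 ≠ 0 := by
  have h1 : 0 < ∫ x, g x :=
    hg.contDiff.continuous.integral_pos_of_hasCompactSupport_nonneg_nonzero hg.hasCompactSupport
      hg.nonneg hg.ne_zero
  have h2 : surfaceFourier χ g 0 = ((∫ x, g x : ℝ) : ℂ) := by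
    rw [surfaceFourier, ← integral_complex_ofReal]
    simp
  rw [h2]
  exact_mod_cast h1.ne'

/-- The frame inequalities, for the modulations of a function on `S` with a smooth density on one
of the patches. -/
theorem IsFrameSpectrum.exists_le_tsum_surfaceFourier_le
    {U : Fin M → Set (EuclideanSpace ℝ (Fin k))}
    {χ : Fin M → EuclideanSpace ℝ (Fin k) → EuclideanSpace ℝ (Fin d)}
    [IsFiniteMeasure (surfaceMeasure U χ)] {Λ : Set (EuclideanSpace ℝ (Fin d))}
    (hΛ : IsFrameSpectrum (surfaceMeasure U χ) Λ) {i : Fin M} (hχ : IsSmoothPatch (U i) (χ i))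
    {x₀ : EuclideanSpace ℝ (Fin k)} {g : EuclideanSpace ℝ (Fin k) → ℝ}
    (hg : IsAmplitude (U i) x₀ g) :
    ∃ a b : ℝ≥0∞, a ≠ 0 ∧ b ≠ ⊤ ∧ ∀ η : EuclideanSpace ℝ (Fin d),
      a ≤ ∑' l : Λ, ‖surfaceFourier (χ i) g (l - η)‖ₑ ^ 2 ∧
      ∑' l : Λ, ‖surfaceFourier (χ i) g (l - η)‖ₑ ^ 2 ≤ b := by
  set σ := surfaceMeasure U χ
  set ν := amplitudeMeasure (U i) (χ i) g
  obtain ⟨K, hK⟩ := hχ.exists_amplitudeMeasure_le hg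
  have hνσ : ν ≤ (K * M : ℝ≥0) • σ := hK.trans (by
    rw [mul_smul]
    exact smul_mono_right K (patchMeasure_le_smul_surfaceMeasure U χ i))
  have hac : ν ≪ σ := (Measure.absolutelyContinuous_of_le hνσ).trans
    (Measure.smul_absolutelyContinuous)
  have hνfin : IsFiniteMeasure ν := ⟨(hνσ _).trans_lt (measure_lt_top _ _)⟩
  -- A bounded density lies in `L²` because `σ` is finite.
  have hbd : ν.rnDeriv σ ≤ᵐ[σ] fun _ => ((K * M : ℝ≥0) : ℝ≥0∞) := by
    refine ae_le_of_forall_setLIntegral_le_of_sigmaFinite (Measure.measurable_rnDeriv _ _)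
      fun s _ _ => (Measure.setLIntegral_rnDeriv_le s).trans ?_
    rw [setLIntegral_const]
    exact hνσ s
  have hdec : ν.HaveLebesgueDecomposition σ := Measure.haveLebesgueDecomposition_of_sigmaFinite _ _
  set h : EuclideanSpace ℝ (Fin d) → ℝ := fun p => (ν.rnDeriv σ p).toReal
  have hh : Measurable h := (Measure.measurable_rnDeriv _ _).ennreal_toReal
  -- Modulation by `η` preserves the `L²` norm and translates the transform, which makes `a` and `b`
  -- independent of `η`.
  set f : EuclideanSpace ℝ (Fin d) → EuclideanSpace ℝ (Fin d) → ℂ := fun η p =>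
    h p • Complex.exp ((2 * Real.pi * inner ℝ p η : ℝ) * Complex.I)
  have hfn : ∀ η p, ‖f η p‖ₑ = ‖h p‖ₑ := fun η p => by
    rw [← ofReal_norm, norm_real_smul_exp_ofReal_mul_I, ← Real.norm_eq_abs, ofReal_norm]
  have hfL : ∀ η, MemLp (f η) 2 σ := fun η => by
    refine MemLp.of_bound (hh.aestronglyMeasurable.smul
      (Continuous.aestronglyMeasurable (by fun_prop))) (K * M : ℝ≥0) ?_
    filter_upwards [hbd] with p hp
    rw [norm_real_smul_exp_ofReal_mul_I, abs_of_nonneg ENNReal.toReal_nonneg]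
    exact ENNReal.toReal_le_of_le_ofReal NNReal.zero_le_coe (by simpa using hp)
  have hfour : ∀ η ξ, fourierOfDensity σ (f η) ξ = surfaceFourier (χ i) g (ξ - η) := fun η ξ => by
    rw [← hχ.integral_amplitudeMeasure hg, ← integral_rnDeriv_smul hac, fourierOfDensity]
    refine integral_congr_ae (ae_of_all _ fun p => ?_)
    simp only [f, h]
    rw [mul_smul_comm, ← Complex.exp_add, inner_sub_right]
    push_cast
    congr 2
    ring
  obtain ⟨-, A, B, hA, hAB, hfr⟩ := hΛ
  set c := ∫⁻ p, ‖h p‖ₑ ^ 2 ∂σ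
  have hc : ∀ η, ∫⁻ p, ‖f η p‖ₑ ^ 2 ∂σ = c := fun η => by simp_rw [hfn, c]
  refine ⟨A * c, B * c, mul_ne_zero (by exact_mod_cast hA.ne') fun h0 => ?_,
    ENNReal.mul_ne_top ENNReal.coe_ne_top ?_, fun η => ?_⟩
  · have h1 : ∀ᵐ p ∂σ, h p = 0 := by
      have := (lintegral_eq_zero_iff (by fun_prop)).1 h0
      filter_upwards [this] with p hp
      simpa using hp
    refine hg.surfaceFourier_zero_ne_zero (χ := χ i) ?_
    rw [← sub_self (0 : EuclideanSpace ℝ (Fin d)), ← hfour, fourierOfDensity]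
    refine integral_eq_zero_of_ae ?_
    filter_upwards [h1] with p hp
    simp [f, hp]
  · rw [← hc 0]
    have := (hfL 0).eLpNorm_lt_top
    have h2 := lintegral_rpow_enorm_lt_top_of_eLpNorm_lt_top two_ne_zero ENNReal.ofNat_ne_top this
    simpa using h2.ne
  · have := hfr (f η) (hfL η)
    simp_rw [hc, hfour] at this
    exact this

end Densities

/-! ### Averages of the weight over large balls. -/

section Averaging

open Filter Topology

theorem continuous_inv_one_add_norm_pow {E : Type*} [NormedAddCommGroup E] (k : ℕ) :
    Continuous fun u : E => ((1 + ‖u‖) ^ k)⁻¹ :=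
  Continuous.inv₀ (by fun_prop) fun u => by positivity

variable {E : Type*} [NormedAddCommGroup E] [InnerProductSpace ℝ E] [FiniteDimensional ℝ E]
  [MeasurableSpace E] [BorelSpace E]

/-- In polar coordinates the radial integrand is `yᵏ (1 + y)⁻ᵏ ≤ 1`, so growth is only linear in the
radius. -/
theorem setIntegral_ball_inv_one_add_norm_pow_le {k : ℕ} (hE : Module.finrank ℝ E = k + 1) {ρ : ℝ}
    (hρ : 0 < ρ) :
    ∫ u in Metric.ball (0 : E) ρ, ((1 + ‖u‖) ^ k)⁻¹ ≤
      (k + 1) * (volume : Measure E).real (Metric.ball 0 1) * ρ := by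
  have hnt : Nontrivial E := Module.nontrivial_of_finrank_pos (R := ℝ) (by omega)
  have h1 : ∫ u in Metric.ball (0 : E) ρ, ((1 + ‖u‖) ^ k)⁻¹ =
      ∫ u : E, (Set.Iio ρ).indicator (fun y : ℝ => ((1 + y) ^ k)⁻¹) ‖u‖ := by
    rw [← integral_indicator measurableSet_ball]
    congr 1
    ext u
    simp [Set.indicator]
  rw [h1, integral_fun_norm_addHaar, hE, Nat.add_sub_cancel, nsmul_eq_mul, smul_eq_mul, ← mul_assoc]
  push_cast
  gcongr
  have h2 : ∫ y in Set.Ioi (0 : ℝ), y ^ k • (Set.Iio ρ).indicator (fun y : ℝ => ((1 + y) ^ k)⁻¹) y =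
      ∫ y in Set.Ioo (0 : ℝ) ρ, y ^ k * ((1 + y) ^ k)⁻¹ := by
    rw [← integral_indicator measurableSet_Ioi, ← integral_indicator measurableSet_Ioo]
    congr 1
    ext y
    by_cases h0 : 0 < y <;> by_cases h3 : y < ρ <;> simp [Set.indicator, h0, h3]
  rw [h2]
  have h3 : ‖∫ y in Set.Ioo (0 : ℝ) ρ, y ^ k * ((1 + y) ^ k)⁻¹‖ ≤ 1 * volume.real (Set.Ioo 0 ρ) := by
    refine norm_setIntegral_le_of_norm_le_const measure_Ioo_lt_top fun y hy => ?_
    have hy0 := hy.1.le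
    rw [Real.norm_of_nonneg (by positivity), ← div_eq_mul_inv]
    refine div_le_one_of_le₀ (pow_le_pow_left₀ hy0 (by linarith) k) (by positivity)
  rw [one_mul, Real.volume_real_Ioo_of_le hρ.le, sub_zero] at h3
  exact (le_abs_self _).trans h3

/-- The average of `(1 + |ζ - ξ|)⁻ᵏ` over `|ξ| < R`, up to a constant factor. -/
noncomputable def ballAverage (k : ℕ) (R : ℝ) (ζ : E) : ℝ :=
  (R ^ (k + 1))⁻¹ * ∫ ξ in Metric.ball (0 : E) R, ((1 + ‖ζ - ξ‖) ^ k)⁻¹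

/-- The translated ball lies in the centred ball of radius `3R`, where the integral is `O(R)`;
dividing by `R ^ (k + 1)` leaves `R⁻ᵏ`. -/
theorem ballAverage_le_of_norm_le {k : ℕ} (hE : Module.finrank ℝ E = k + 1) {R : ℝ} (hR : 0 < R)
    {ζ : E} (hζ : ‖ζ‖ ≤ 2 * R) :
    ballAverage k R ζ ≤ 3 * ((k + 1) * (volume : Measure E).real (Metric.ball 0 1)) *
      (R ^ k)⁻¹ := by
  have hint : ∀ r, IntegrableOn (fun u : E => ((1 + ‖u‖) ^ k)⁻¹) (Metric.ball 0 r) := fun r =>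
    ((continuous_inv_one_add_norm_pow k).continuousOn.integrableOn_compact
      (isCompact_closedBall (0 : E) r)).mono_set Metric.ball_subset_closedBall
  have h1 : ∫ ξ in Metric.ball (0 : E) R, ((1 + ‖ζ - ξ‖) ^ k)⁻¹ ≤
      ∫ u in Metric.ball (0 : E) (3 * R), ((1 + ‖u‖) ^ k)⁻¹ := by
    rw [← integral_indicator measurableSet_ball, ← integral_indicator measurableSet_ball,
      ← integral_sub_left_eq_self (fun u : E => (Metric.ball (0 : E) (3 * R)).indicator
        (fun u => ((1 + ‖u‖) ^ k)⁻¹) u) volume ζ]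
    refine integral_mono_of_nonneg (ae_of_all _ fun u => ?_) ?_ (ae_of_all _ fun u => ?_)
    · exact Set.indicator_nonneg (fun _ _ => by positivity) _
    · exact ((hint _).integrable_indicator measurableSet_ball).comp_sub_left ζ
    · by_cases hu : u ∈ Metric.ball (0 : E) R
      · have h2 : ζ - u ∈ Metric.ball (0 : E) (3 * R) := by
          have h3 := norm_sub_le ζ u
          simp only [mem_ball_zero_iff] at hu ⊢
          linarith
        simp only [Set.indicator_of_mem hu, Set.indicator_of_mem h2, le_refl]
      · simp only [Set.indicator_of_notMem hu]
        exact Set.indicator_nonneg (fun _ _ => by positivity) _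
  have h2 := h1.trans (setIntegral_ball_inv_one_add_norm_pow_le hE (by positivity : 0 < 3 * R))
  calc ballAverage k R ζ ≤ (R ^ (k + 1))⁻¹ *
        ((k + 1) * (volume : Measure E).real (Metric.ball 0 1) * (3 * R)) := by
        unfold ballAverage; gcongr
    _ = _ := by field_simp; ring

theorem ballAverage_le_of_le_norm {k : ℕ} (hE : Module.finrank ℝ E = k + 1) {R : ℝ} (hR : 0 < R)
    {ζ : E} (hζ : 2 * R ≤ ‖ζ‖) :
    ballAverage k R ζ ≤ 2 ^ k * (volume : Measure E).real (Metric.ball 0 1) *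
      ((1 + ‖ζ‖) ^ k)⁻¹ := by
  have hvol : (volume : Measure E).real (Metric.ball 0 R) =
      R ^ (k + 1) * (volume : Measure E).real (Metric.ball 0 1) := by
    rw [Measure.real, Measure.addHaar_ball_of_pos _ _ hR, ENNReal.toReal_mul,
      ENNReal.toReal_ofReal (by positivity), hE]
    rfl
  have h1 : ‖∫ ξ in Metric.ball (0 : E) R, ((1 + ‖ζ - ξ‖) ^ k)⁻¹‖ ≤
      2 ^ k * ((1 + ‖ζ‖) ^ k)⁻¹ * (volume : Measure E).real (Metric.ball 0 R) := by
    refine norm_setIntegral_le_of_norm_le_const measure_ball_lt_top fun ξ hξ => ?_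
    rw [Real.norm_of_nonneg (by positivity), ← div_eq_mul_inv, inv_le_comm₀ (by positivity)
      (by positivity), inv_div, ← div_pow]
    -- Since `‖ξ‖ < R ≤ ‖ζ‖ / 2`, the translate satisfies `1 + ‖ζ - ξ‖ ≥ (1 + ‖ζ‖) / 2`.
    refine pow_le_pow_left₀ (by positivity) ?_ k
    have h2 := norm_sub_norm_le ζ ξ
    rw [mem_ball_zero_iff] at hξ
    linarith
  rw [hvol] at h1
  calc ballAverage k R ζ ≤ (R ^ (k + 1))⁻¹ * (2 ^ k * ((1 + ‖ζ‖) ^ k)⁻¹ *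
        (R ^ (k + 1) * (volume : Measure E).real (Metric.ball 0 1))) := by
        unfold ballAverage; gcongr; exact (le_abs_self _).trans h1
    _ = _ := by field_simp

theorem exists_ballAverage_le {k : ℕ} (hE : Module.finrank ℝ E = k + 1) :
    ∃ D : ℝ, ∀ R : ℝ, 1 ≤ R → ∀ ζ : E, ballAverage k R ζ ≤ D * ((1 + ‖ζ‖) ^ k)⁻¹ := by
  set v := (volume : Measure E).real (Metric.ball 0 1)
  have hv : 0 ≤ v := measureReal_nonneg
  refine ⟨max (3 * ((k + 1) * v) * 3 ^ k) (2 ^ k * v), fun R hR ζ => ?_⟩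
  have hR0 := one_pos.trans_le hR
  rcases le_total ‖ζ‖ (2 * R) with h | h
  · refine (ballAverage_le_of_norm_le hE hR0 h).trans ?_
    have h1 : (R ^ k)⁻¹ ≤ 3 ^ k * ((1 + ‖ζ‖) ^ k)⁻¹ := by
      rw [← div_eq_mul_inv, inv_le_comm₀ (by positivity) (by positivity), inv_div, ← div_pow]
      refine pow_le_pow_left₀ (by positivity) ?_ k
      rw [div_le_iff₀ (by norm_num)]
      linarith
    calc 3 * ((k + 1) * v) * (R ^ k)⁻¹ ≤ 3 * ((k + 1) * v) * (3 ^ k * ((1 + ‖ζ‖) ^ k)⁻¹) := by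
          gcongr
      _ = 3 * ((k + 1) * v) * 3 ^ k * ((1 + ‖ζ‖) ^ k)⁻¹ := by ring
      _ ≤ _ := by gcongr; exact le_max_left _ _
  · refine (ballAverage_le_of_le_norm hE hR0 h).trans ?_
    gcongr
    exact le_max_right _ _

theorem tendsto_ballAverage {k : ℕ} (hk : k ≠ 0) (hE : Module.finrank ℝ E = k + 1) (ζ : E) :
    Tendsto (fun R : ℝ => ballAverage k R ζ) atTop (𝓝 0) := by
  refine tendsto_of_tendsto_of_tendsto_of_le_of_le' tendsto_const_nhds
    (h := fun R : ℝ => 3 * ((k + 1) * (volume : Measure E).real (Metric.ball 0 1)) * (R ^ k)⁻¹)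
    ?_ ?_ ?_
  · simpa using ((tendsto_pow_atTop hk).inv_tendsto_atTop (𝕜 := ℝ)).const_mul
      (3 * ((k + 1) * (volume : Measure E).real (Metric.ball 0 1)))
  · filter_upwards [eventually_gt_atTop 0] with R hR
    exact mul_nonneg (by positivity) (integral_nonneg fun ξ => by positivity)
  · filter_upwards [eventually_gt_atTop 0, eventually_ge_atTop ‖ζ‖] with R hR hζ
    exact ballAverage_le_of_norm_le hE hR (by linarith)

/-- A function with square at most `C (1 + |·|)⁻ᵏ` does not satisfy the lower frame inequality, for
frequencies along which `(1 + |·|)⁻ᵏ` is summable. -/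
theorem eq_zero_of_forall_le_tsum_enorm_sq {k : ℕ} (hk : k ≠ 0) (hE : Module.finrank ℝ E = k + 1)
    {Λ : Set E} [Countable Λ] (hΛ : ∑' l : Λ, ENNReal.ofReal ((1 + ‖(l : E)‖) ^ k)⁻¹ ≠ ⊤)
    {f : E → ℂ} {C : ℝ} (hf : ∀ ξ, (1 + ‖ξ‖) ^ k * ‖f ξ‖ ^ 2 ≤ C) {a : ℝ≥0∞}
    (ha : ∀ η : E, a ≤ ∑' l : Λ, ‖f (l - η)‖ₑ ^ 2) : a = 0 := by
  have hC0 : 0 ≤ C := le_trans (by positivity) (hf 0)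
  have hf' : ∀ ξ, ‖f ξ‖ₑ ^ 2 ≤ ENNReal.ofReal (C * ((1 + ‖ξ‖) ^ k)⁻¹) := fun ξ => by
    rw [← ofReal_norm, ← ENNReal.ofReal_pow (norm_nonneg _)]
    refine ENNReal.ofReal_le_ofReal ?_
    rw [← div_eq_mul_inv, le_div_iff₀ (by positivity), mul_comm]
    exact hf ξ
  obtain ⟨D, hD⟩ := exists_ballAverage_le hE
  have hcont : ∀ ζ : E, Continuous fun ξ : E => ((1 + ‖ζ - ξ‖) ^ k)⁻¹ := fun ζ =>
    (continuous_inv_one_add_norm_pow k).comp (continuous_const.sub continuous_id)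
  set v := (volume : Measure E) (Metric.ball 0 1)
  have hv0 : v ≠ 0 := (Metric.measure_ball_pos _ _ one_pos).ne'
  -- Integrate the lower frame bound over the shifts `‖η‖ < R`; the factor `v` appears because
  -- `ballAverage` divides by `R ^ (k + 1)` only.
  have hmain : ∀ R : ℝ, 1 ≤ R → a * v ≤ ∑' l : Λ, ENNReal.ofReal (C * ballAverage k R (l : E)) := by
    intro R hR
    have hR0 := one_pos.trans_le hR
    have h1 : a * (ENNReal.ofReal (R ^ (k + 1)) * v) ≤
        ENNReal.ofReal (R ^ (k + 1)) *
          ∑' l : Λ, ENNReal.ofReal (C * ballAverage k R (l : E)) := by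
      calc a * (ENNReal.ofReal (R ^ (k + 1)) * v)
          = ∫⁻ _ in Metric.ball (0 : E) R, a := by
            rw [setLIntegral_const, Measure.addHaar_ball_of_pos _ _ hR0, hE]
        _ ≤ ∫⁻ η in Metric.ball (0 : E) R,
            ∑' l : Λ, ENNReal.ofReal (C * ((1 + ‖(l : E) - η‖) ^ k)⁻¹) :=
            lintegral_mono fun η => (ha η).trans (ENNReal.tsum_le_tsum fun l => hf' _)
        _ = ∑' l : Λ, ∫⁻ η in Metric.ball (0 : E) R,
            ENNReal.ofReal (C * ((1 + ‖(l : E) - η‖) ^ k)⁻¹) :=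
            lintegral_tsum fun l =>
              ((hcont l).const_mul C).measurable.ennreal_ofReal.aemeasurable
        _ = ∑' l : Λ, ENNReal.ofReal (R ^ (k + 1)) *
            ENNReal.ofReal (C * ballAverage k R (l : E)) := by
            refine tsum_congr fun l => ?_
            rw [← ofReal_integral_eq_lintegral_ofReal, integral_const_mul,
              ← ENNReal.ofReal_mul (by positivity), ballAverage]
            · congr 1
              field_simp
            · exact ((((hcont l).const_mul C).continuousOn.integrableOn_compact
                (isCompact_closedBall (0 : E) R)).mono_set Metric.ball_subset_closedBall)
            · exact ae_of_all _ fun η => by positivity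
        _ = _ := ENNReal.tsum_mul_left
    rw [mul_left_comm] at h1
    exact (ENNReal.mul_le_mul_iff_right
      (by simp only [ne_eq, ENNReal.ofReal_eq_zero, not_le]; positivity)
      ENNReal.ofReal_ne_top).1 h1
  have hlim : Tendsto (fun N : ℕ => ∑' l : Λ, ENNReal.ofReal (C * ballAverage k (N : ℝ) (l : E)))
      atTop (𝓝 0) := by
    have h1 : ∀ f : Λ → ℝ≥0∞, ∫⁻ l, f l ∂Measure.count = ∑' l, f l := fun f => lintegral_count f
    simp_rw [← h1]
    rw [← lintegral_zero (μ := (Measure.count : Measure Λ))]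
    -- Dominated convergence for counting measure on `Λ`, with the summable weight as majorant.
    refine tendsto_lintegral_filter_of_dominated_convergence
      (fun l : Λ => ENNReal.ofReal (C * D) * ENNReal.ofReal ((1 + ‖(l : E)‖) ^ k)⁻¹)
      (Eventually.of_forall fun N => measurable_of_countable _) ?_ ?_ ?_
    · filter_upwards [eventually_ge_atTop 1] with N hN
      refine ae_of_all _ fun l => ?_
      rw [← ENNReal.ofReal_mul' (by positivity)]
      refine ENNReal.ofReal_le_ofReal ?_
      rw [mul_assoc]
      gcongr
      exact hD _ (by exact_mod_cast hN) _
    · rw [h1, ENNReal.tsum_mul_left]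
      exact ENNReal.mul_ne_top ENNReal.ofReal_ne_top hΛ
    · refine ae_of_all _ fun l => ?_
      have h2 := ((tendsto_ballAverage hk hE (l : E)).comp
        (tendsto_natCast_atTop_atTop (R := ℝ))).const_mul C
      rw [mul_zero] at h2
      simpa using ENNReal.tendsto_ofReal h2
  have h0 : a * v ≤ 0 := ge_of_tendsto hlim (by
    filter_upwards [eventually_ge_atTop 1] with N hN using hmain N (by exact_mod_cast hN))
  exact (mul_eq_zero.1 (nonpos_iff_eq_zero.1 h0)).resolve_right hv0

end Averaging

/-! ### Summability of the weight over a frame spectrum, and the contradiction. -/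

section FrameSpectra

open Filter Topology

variable {k d M : ℕ}

/-- The frequencies in `A ∩ Λ` are summable with the weight `(1 + |·|)⁻ᵏ`. -/
def WeightSummableOn {E : Type*} [NormedAddCommGroup E] (k : ℕ) (Λ A : Set E) : Prop :=
  ∑' l : Λ, A.indicator (fun ξ => ENNReal.ofReal ((1 + ‖ξ‖) ^ k)⁻¹) (l : E) ≠ ⊤

namespace WeightSummableOn

variable {E : Type*} [NormedAddCommGroup E] {Λ A A' : Set E}

theorem mono (h : WeightSummableOn k Λ A') (hA : A ⊆ A') : WeightSummableOn k Λ A :=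
  ne_top_of_le_ne_top h (ENNReal.tsum_le_tsum fun _ =>
    Set.indicator_le_indicator_of_subset hA (fun _ => zero_le) _)

theorem empty : WeightSummableOn k Λ ∅ := by simp [WeightSummableOn]

theorem union (h : WeightSummableOn k Λ A) (h' : WeightSummableOn k Λ A') :
    WeightSummableOn k Λ (A ∪ A') := by
  refine ne_top_of_le_ne_top (ENNReal.add_ne_top.2 ⟨h, h'⟩) ?_
  rw [← ENNReal.tsum_add]
  refine ENNReal.tsum_le_tsum fun l => ?_
  by_cases h1 : (l : E) ∈ A <;> by_cases h2 : (l : E) ∈ A' <;> simp [Set.indicator, h1, h2]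

theorem of_le {f : E → ℂ} {κ : ℝ} (hκ : 0 < κ) {b : ℝ≥0∞} (hb : b ≠ ⊤)
    (hf : ∑' l : Λ, ‖f l‖ₑ ^ 2 ≤ b) (hA : ∀ ξ ∈ A, κ ≤ (1 + ‖ξ‖) ^ k * ‖f ξ‖ ^ 2) :
    WeightSummableOn k Λ A := by
  refine ne_top_of_le_ne_top (b := ENNReal.ofReal κ⁻¹ * ∑' l : Λ, ‖f l‖ₑ ^ 2)
    (ENNReal.mul_ne_top ENNReal.ofReal_ne_top (ne_top_of_le_ne_top hb hf)) ?_
  rw [← ENNReal.tsum_mul_left]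
  refine ENNReal.tsum_le_tsum fun l => ?_
  by_cases hl : (l : E) ∈ A
  · rw [Set.indicator_of_mem hl, ← ofReal_norm, ← ENNReal.ofReal_pow (norm_nonneg _),
      ← ENNReal.ofReal_mul (by positivity)]
    refine ENNReal.ofReal_le_ofReal ?_
    rw [inv_le_iff_one_le_mul₀ (by positivity), mul_assoc, inv_mul_eq_div, le_div_iff₀ hκ, one_mul,
      mul_comm]
    exact hA _ hl
  · rw [Set.indicator_of_notMem hl]; exact zero_le

end WeightSummableOn

/-- The unit normals of a patch over a compact set of parameters form a compact set. -/
theorem IsSmoothPatch.isCompact_unit_normals {U : Set (EuclideanSpace ℝ (Fin k))}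
    {χ : EuclideanSpace ℝ (Fin k) → EuclideanSpace ℝ (Fin d)} (hχ : IsSmoothPatch U χ)
    {K : Set (EuclideanSpace ℝ (Fin k))} (hK : IsCompact K) (hKU : K ⊆ U) :
    IsCompact {η : EuclideanSpace ℝ (Fin d) | ‖η‖ = 1 ∧ ∃ x ∈ K, η ∈ patchNormal χ x} := by
  have h1 : ContinuousOn (fderiv ℝ χ) K :=
    (hχ.contDiffOn.continuousOn_fderiv_of_isOpen hχ.isOpen (by simp)).mono hKU
  set P := K ×ˢ Metric.sphere (0 : EuclideanSpace ℝ (Fin d)) 1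
  have hP : IsCompact P := hK.prod (isCompact_sphere _ _)
  have h2 : ∀ v, IsClosed
      (P ∩ (fun p => inner ℝ (fderiv ℝ χ p.1 v) p.2) ⁻¹' {(0 : ℝ)}) := fun v => by
    refine ContinuousOn.preimage_isClosed_of_isClosed ?_ hP.isClosed isClosed_singleton
    exact ((h1.comp continuousOn_fst fun p hp => hp.1).clm_apply continuousOn_const).inner
      continuousOn_snd
  have h3 : IsCompact (P ∩ ⋂ v, P ∩ (fun p => inner ℝ (fderiv ℝ χ p.1 v) p.2) ⁻¹' {(0 : ℝ)}) :=
    hP.inter_right (isClosed_iInter h2)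
  convert h3.image continuous_snd using 1
  ext η
  simp only [Set.mem_ofPred_eq, mem_patchNormal_iff]
  constructor
  · rintro ⟨h1, x, hx, hη⟩
    have hP : (x, η) ∈ P := ⟨hx, by simpa using h1⟩
    exact ⟨(x, η), ⟨hP, Set.mem_iInter.2 fun v => ⟨hP, hη v⟩⟩, rfl⟩
  · rintro ⟨⟨x, η'⟩, ⟨hP, hη⟩, rfl⟩
    exact ⟨by simpa using hP.2, x, hP.1, fun v => (Set.mem_iInter.1 hη v).2⟩

/-- A frame spectrum is summable with the weight `(1 + |·|)⁻ᵏ` over bounded sets. -/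
theorem IsFrameSpectrum.weightSummableOn_closedBall
    {U : Fin M → Set (EuclideanSpace ℝ (Fin k))}
    {χ : Fin M → EuclideanSpace ℝ (Fin k) → EuclideanSpace ℝ (Fin d)}
    [IsFiniteMeasure (surfaceMeasure U χ)] {Λ : Set (EuclideanSpace ℝ (Fin d))}
    (hΛ : IsFrameSpectrum (surfaceMeasure U χ) Λ) {i : Fin M} (hχ : IsSmoothPatch (U i) (χ i))
    (hK : HasNonvanishingCurvature (U i) (χ i))
    {x₀ : EuclideanSpace ℝ (Fin k)} (hx₀ : x₀ ∈ U i) (R : ℝ) :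
    WeightSummableOn k Λ (Metric.closedBall 0 R) := by
  obtain ⟨g, hg, hcont, -⟩ := hχ.exists_isAmplitude_decay hK hx₀
  obtain ⟨a, b, -, hb, hab⟩ := hΛ.exists_le_tsum_surfaceFourier_le hχ hg
  refine (isCompact_closedBall (0 : EuclideanSpace ℝ (Fin d)) R).induction_on
    (p := WeightSummableOn k Λ) .empty (fun s t hst ht => ht.mono hst)
    (fun s t hs ht => hs.union ht) fun η _ => ?_
  have h0 : 0 < ‖surfaceFourier (χ i) g 0‖ ^ 2 :=
    pow_pos (norm_pos_iff.2 hg.surfaceFourier_zero_ne_zero) 2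
  -- The transform is nonzero at the origin, so its translate by `η` is bounded below near `η`, and
  -- the upper frame bound holds for every translate.
  have hev : ∀ᶠ ξ in 𝓝 η, ‖surfaceFourier (χ i) g 0‖ ^ 2 / 2 <
      ‖surfaceFourier (χ i) g (ξ - η)‖ ^ 2 := by
    have h1 : Continuous fun ξ => ‖surfaceFourier (χ i) g (ξ - η)‖ ^ 2 :=
      (hcont.comp (continuous_id.sub continuous_const)).norm.pow 2
    exact h1.continuousAt.eventually_const_lt (by simpa using half_lt_self h0)
  refine ⟨_, mem_nhdsWithin_of_mem_nhds hev, ?_⟩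
  refine .of_le (f := fun ξ => surfaceFourier (χ i) g (ξ - η)) (half_pos h0) hb (hab η).2
    fun ξ hξ => (le_of_lt hξ).trans ?_
  exact le_mul_of_one_le_left (by positivity) (one_le_pow₀ (by linarith [norm_nonneg ξ]))

/-- A frame spectrum is summable with the weight `(1 + |·|)⁻ᵏ` over cones around the normals. -/
theorem IsFrameSpectrum.exists_weightSummableOn_cone
    {U : Fin M → Set (EuclideanSpace ℝ (Fin k))}
    {χ : Fin M → EuclideanSpace ℝ (Fin k) → EuclideanSpace ℝ (Fin d)}
    [IsFiniteMeasure (surfaceMeasure U χ)] {Λ : Set (EuclideanSpace ℝ (Fin d))}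
    (hΛ : IsFrameSpectrum (surfaceMeasure U χ) Λ) {i : Fin M} (hχ : IsSmoothPatch (U i) (χ i))
    (hK : HasNonvanishingCurvature (U i) (χ i)) {x₀ : EuclideanSpace ℝ (Fin k)} (hx₀ : x₀ ∈ U i)
    {η₀ : EuclideanSpace ℝ (Fin d)} (hη1 : ‖η₀‖ = 1) (hη : η₀ ∈ patchNormal (χ i) x₀) :
    ∃ N ∈ 𝓝 η₀, ∃ R : ℝ, WeightSummableOn k Λ {ξ | R ≤ ‖ξ‖ ∧ ‖ξ‖⁻¹ • ξ ∈ N} := by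
  obtain ⟨g, hg, κ, hκ, hev⟩ := hχ.exists_isAmplitude_le hK hx₀ hη1 hη
  obtain ⟨a, b, -, hb, hab⟩ := hΛ.exists_le_tsum_surfaceFourier_le hχ hg
  obtain ⟨N, hN, T, hT, hNT⟩ := eventually_prod_iff.1 hev
  obtain ⟨R, hR⟩ := eventually_atTop.1 hT
  -- The radius at least `1` keeps `ξ` away from zero, so that `ξ` is recovered from its direction
  -- and norm.
  refine ⟨{η | N η}, hN, max R 1, ?_⟩
  refine .of_le (f := fun ξ => surfaceFourier (χ i) g (ξ - 0)) hκ hb (hab 0).2 fun ξ hξ => ?_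
  have h1 : ‖ξ‖ ≠ 0 := (one_pos.trans_le ((le_max_right _ _).trans hξ.1)).ne'
  have h2 := hNT hξ.2 (hR ‖ξ‖ ((le_max_left _ _).trans hξ.1))
  rw [smul_inv_smul₀ h1] at h2
  rw [sub_zero]
  refine h2.trans ?_
  gcongr
  linarith

theorem IsFrameSpectrum.weightSummableOn_of_subset_normalLines
    {U V : Fin M → Set (EuclideanSpace ℝ (Fin k))}
    {χ : Fin M → EuclideanSpace ℝ (Fin k) → EuclideanSpace ℝ (Fin d)}
    (hχ : ∀ i, IsSmoothPatch (U i) (χ i)) (hK : ∀ i, HasNonvanishingCurvature (U i) (χ i))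
    (hne : (⋃ i, χ i '' U i).Nonempty) [IsFiniteMeasure (surfaceMeasure U χ)]
    {Λ : Set (EuclideanSpace ℝ (Fin d))} (hΛ : IsFrameSpectrum (surfaceMeasure U χ) Λ)
    (hV : IsCompactlyContained V U) (hsub : Λ ⊆ normalLines V χ) :
    ∑' l : Λ, ENNReal.ofReal ((1 + ‖(l : EuclideanSpace ℝ (Fin d))‖) ^ k)⁻¹ ≠ ⊤ := by
  obtain ⟨-, ⟨-, ⟨i, rfl⟩, x₀, hx₀, -⟩⟩ := hne
  -- Closures make the set of unit normals compact; they stay inside the `U j`, where the curvature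
  -- estimates apply.
  set Q : Set (EuclideanSpace ℝ (Fin d)) :=
    ⋃ j, {η | ‖η‖ = 1 ∧ ∃ x ∈ closure (V j), η ∈ patchNormal (χ j) x}
  have hQ : IsCompact Q := isCompact_iUnion fun j =>
    (hχ j).isCompact_unit_normals (hV j).2.1 (hV j).2.2
  obtain ⟨R, hR⟩ : ∃ R : ℝ, WeightSummableOn k Λ {ξ | R ≤ ‖ξ‖ ∧ ‖ξ‖⁻¹ • ξ ∈ Q} := by
    refine hQ.induction_on (p := fun s => ∃ R : ℝ,
      WeightSummableOn k Λ {ξ | R ≤ ‖ξ‖ ∧ ‖ξ‖⁻¹ • ξ ∈ s}) ?_ ?_ ?_ ?_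
    · exact ⟨0, WeightSummableOn.empty.mono (by simp)⟩
    · rintro s t hst ⟨R, hR⟩
      exact ⟨R, hR.mono fun ξ hξ => ⟨hξ.1, hst hξ.2⟩⟩
    · rintro s t ⟨R, hR⟩ ⟨R', hR'⟩
      refine ⟨max R R', (hR.union hR').mono ?_⟩
      rintro ξ ⟨h1, h2 | h2⟩
      exacts [.inl ⟨(le_max_left _ _).trans h1, h2⟩, .inr ⟨(le_max_right _ _).trans h1, h2⟩]
    · intro η hη
      obtain ⟨j, hη1, x, hx, hηx⟩ := Set.mem_iUnion.1 hη
      obtain ⟨N, hN, h⟩ :=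
        hΛ.exists_weightSummableOn_cone (hχ j) (hK j) ((hV j).2.2 hx) hη1 hηx
      exact ⟨N, mem_nhdsWithin_of_mem_nhds hN, h⟩
  have hball := hΛ.weightSummableOn_closedBall (hχ i) (hK i) hx₀ (max R 1)
  have hall := hball.union hR
  refine ne_top_of_le_ne_top hall (ENNReal.tsum_le_tsum fun l => ?_)
  rw [Set.indicator_of_mem]
  rcases le_total ‖(l : EuclideanSpace ℝ (Fin d))‖ (max R 1) with h | h
  · exact .inl (by simpa using h)
  · refine .inr ⟨(le_max_left _ _).trans h, ?_⟩
    have h0 : ‖(l : EuclideanSpace ℝ (Fin d))‖ ≠ 0 :=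
      (one_pos.trans_le ((le_max_right _ _).trans h)).ne'
    obtain ⟨j, hj⟩ := Set.mem_iUnion.1 (hsub l.2)
    obtain ⟨x, hx⟩ := Set.mem_iUnion.1 hj
    obtain ⟨hxV, hl⟩ := Set.mem_iUnion.1 hx
    exact Set.mem_iUnion.2 ⟨j, by simp [norm_smul, h0], x, subset_closure hxV,
      Submodule.smul_mem _ _ hl⟩

theorem IsFrameSpectrum.not_subset_normalLines (hd : d = k + 1) (hk : k ≠ 0)
    {U V : Fin M → Set (EuclideanSpace ℝ (Fin k))}
    {χ : Fin M → EuclideanSpace ℝ (Fin k) → EuclideanSpace ℝ (Fin d)}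
    (hχ : ∀ i, IsSmoothPatch (U i) (χ i)) (hK : ∀ i, HasNonvanishingCurvature (U i) (χ i))
    (hne : (⋃ i, χ i '' U i).Nonempty) [IsFiniteMeasure (surfaceMeasure U χ)]
    {Λ : Set (EuclideanSpace ℝ (Fin d))} (hΛ : IsFrameSpectrum (surfaceMeasure U χ) Λ)
    (hV : IsCompactlyContained V U) : ¬ Λ ⊆ normalLines V χ := by
  intro hsub
  have hsum := hΛ.weightSummableOn_of_subset_normalLines hχ hK hne hV hsub
  obtain ⟨-, ⟨-, ⟨i, rfl⟩, x₀, hx₀, -⟩⟩ := hne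
  obtain ⟨g, hg, -, C, hC⟩ := (hχ i).exists_isAmplitude_decay (hK i) hx₀
  obtain ⟨a, b, ha, -, hab⟩ := hΛ.exists_le_tsum_surfaceFourier_le (hχ i) hg
  have : DiscreteTopology Λ := hΛ.1
  have : Countable Λ := countable_of_Lindelof_of_discrete
  exact ha (eq_zero_of_forall_le_tsum_enorm_sq hk (by rw [finrank_euclideanSpace_fin, hd]) hsum hC
    fun η => (hab η).1)

end FrameSpectra

theorem theorem1p1 (d : ℕ) (hd : 2 ≤ d) (M : ℕ)
    (U : Fin M → Set (EuclideanSpace ℝ (Fin (d - 1))))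
    (χ : Fin M → EuclideanSpace ℝ (Fin (d - 1)) → EuclideanSpace ℝ (Fin d))
    (hχ : ∀ i, IsSmoothPatch (U i) (χ i))
    (hK : ∀ i, HasNonvanishingCurvature (U i) (χ i))
    (hne : (⋃ i, χ i '' U i).Nonempty)
    (hfin : IsFiniteMeasure (surfaceMeasure U χ)) :
    (∀ Λ : Set (EuclideanSpace ℝ (Fin d)), IsFrameSpectrum (surfaceMeasure U χ) Λ →
      ∀ V : Fin M → Set (EuclideanSpace ℝ (Fin (d - 1))), IsCompactlyContained V U →
        (Λ ∩ (normalLines V χ)ᶜ).Nonempty) ∧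
    ((∃ V : Fin M → Set (EuclideanSpace ℝ (Fin (d - 1))), IsCompactlyContained V U ∧
        normalLines V χ = Set.univ) →
      ¬ AdmitsFourierFrame (surfaceMeasure U χ)) := by
  have key : ∀ Λ : Set (EuclideanSpace ℝ (Fin d)), IsFrameSpectrum (surfaceMeasure U χ) Λ →
      ∀ V : Fin M → Set (EuclideanSpace ℝ (Fin (d - 1))), IsCompactlyContained V U →
        ¬ Λ ⊆ normalLines V χ := fun Λ hΛ V hV =>
    hΛ.not_subset_normalLines (by omega) (by omega) hχ hK hne hV
  refine ⟨fun Λ hΛ V hV => ?_, ?_⟩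
  · rw [← Set.sdiff_eq, Set.sdiff_nonempty]
    exact key Λ hΛ V hV
  · rintro ⟨V, hV, huniv⟩ ⟨Λ, hΛ⟩
    exact key Λ hΛ V hV (huniv ▸ Set.subset_univ Λ)
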